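/- Let $p\ge 0$, $k\ge 1$, $r\in\{0,\dots,p\}$, $c\in\mathbb R^p$ and $f_0,\dots,f_k:\mathbb R^p\to\mathbb R^p$, and consider the nonlinear VAR $$f_0(z_t)=c+\sum_{i=1}^k f_i(z_{t-i})+u_t .$$ Put $g_j(z)=-\sum_{i=j+1}^k f_i(z)$ and $\pi(z)=-f_0(z)+\sum_{i=1}^k f_i(z)$. Let $D\in\mathbb R^{p(k-1)\times p(k-1)}$ be the block matrix with blocks $-I_p$ on the diagonal, $I_p$ on the first superdiagonal and $0$ elsewhere, let $E=[I_p;0]\in\mathbb R^{p(k-1)\times p}$ (these are empty if $k=1$), and for $\alpha\in\mathbb R^{p\times r}$ put $$\boldsymbol D_0=\begin{bmatrix}0_{r\times p}&0\\0&D\end{bmatrix},\qquad \boldsymbol\alpha=\begin{bmatrix}\alpha&E'\\0&I_{p(k-1)}\end{bmatrix}.$$ For a bounded set $\mathcal A$ of square matrices let $\rho_{\mathrm{JSR}}(\mathcal A)=\limsup_{t\to\infty}\sup_{B\in\mathcal A^t}\rho(B)^{1/t}$, where $\mathcal A^t$ is the set of $t$-fold products of members of $\mathcal A$ and $\rho$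 is the spectral radius. Assume that, for some $\alpha\in\mathbb R^{p\times r}$ of rank $r$, $\bar b\in\mathbb R$ and $\bar\rho\in[0,1)$, the model belongs to the class $\mathrm{CVAR}_r(\alpha,\bar b,\bar\rho)$, i.e.: (i) $f_0$ is a homeomorphism of $\mathbb R^p$; (ii) there are $\mu\in\mathbb R^r$ and $\theta:\mathbb R^p\to\mathbb R^r$ with $c=\alpha\mu$ and $\pi(z)=\alpha\theta(z)$ for all $z\in\mathbb R^p$; (iii) with $\boldsymbol\theta=(\theta',g_1',\dots,g_{k-1}')'$, there is a closed set $\mathcal B\subset\mathbb R^{pk\times[p(k-1)+r]}$ with $\|\boldsymbol\beta\|\le\bar b$ for all $\boldsymbol\beta\in\mathcal B$ (norm induced by the Euclidean norms) and $\rho_{\mathrm{JSR}}(\{I_{p(k-1)+r}+\boldsymbol\beta'\boldsymbol\alpha:\boldsymbol\beta\in\mathcal B\})\le\bar\rho$, such that for all $\boldsymbol z=(z',\boldsymbol\zeta')'$ and $\tilde{\boldsymbol z}=(\tilde z',\tilde{\boldsymbol\zeta}')'$ in $\mathbb R^p\times\mathbb R^{p(k-1)}$ there is $\boldsymbol\beta\in\mathcal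 B$ with $$[\boldsymbol\theta(f_0^{-1}(z))+\boldsymbol D_0\boldsymbol z]-[\boldsymbol\theta(f_0^{-1}(\tilde z))+\boldsymbol D_0\tilde{\boldsymbol z}]=\boldsymbol\beta'(\boldsymbol z-\tilde{\boldsymbol z}).$$ For a state $\varsigma=(\varsigma_{(1)},\dots,\varsigma_{(k)})\in\mathbb R^{kp}$ and $u\in\mathbb R^p$, let $z_t(u;\varsigma)$, $t\ge\tau$, be the solution of the model with $z_{\tau-i}=\varsigma_{(i)}$ for $i=1,\dots,k$, $u_\tau=u$ and $u_t=0$ for $t>\tau$. Then: (a) for all $u$ and $\varsigma$ the limit $z_\infty(u;\varsigma)=\lim_{t\to\infty}z_t(u;\varsigma)$ exists; (b) for every $\varsigma\in\mathbb R^{kp}$, $$\{u\in\mathbb R^p: z_\infty(u;\varsigma)=z_\infty(0;\varsigma)\}=\operatorname{span}\alpha,$$ where $\operatorname{span}\alpha$ is the column span of $\alpha$; that is, a shock $u$ has no permanent effect from $\varsigma$, in the sense that $z_t(u;\varsigma)-z_t(0;\varsigma)\to0$ as $t\to\infty$, if and only if $u\in\operatorname{span}\alpha$; (c) let $\alpha_\perp\in\mathbb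 R^{p\times(p-r)}$ have rank $p-r$ with $\alpha_\perp'\alpha=0$, let $\Upsilon\in\mathbb R^{p\times p}$ be orthogonal, and let $m\in\{1,\dots,r\}$. For every $\varsigma$, the structural shocks in the first $m$ coordinates have no permanent effect from $\varsigma$ (i.e. $u=\Upsilon\begin{bmatrix}I_m\\0\end{bmatrix}\varepsilon_{(1)}$ has none, for every $\varepsilon_{(1)}\in\mathbb R^m$) if and only if every column of $\Upsilon\begin{bmatrix}I_m\\0\end{bmatrix}$ lies in $\operatorname{span}\alpha$, and the latter holds if and only if $$\alpha_\perp'\Upsilon\begin{bmatrix}I_m\\0_{(p-m)\times m}\end{bmatrix}=0 .$$ -/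

import Mathlib

open Filter Topology

noncomputable section

/-- Parameters of the additively time-separable nonlinear VAR with `k` lags,
`f 0 (z t) = c + ∑_{i=1}^k f i (z (t - i)) + u t`.
Only the values `f 0, ..., f k` are ever used. -/
structure NonlinearVAR (p k : ℕ) where
  /-- the intercept -/
  c : Fin p → ℝ
  /-- the maps `f 0, ..., f k` -/
  f : ℕ → (Fin p → ℝ) → (Fin p → ℝ)

/-- The matrix norm induced by the Euclidean vector norms. -/
def inducedNorm {m n : Type*} [Fintype m] [Fintype n] [DecidableEq n]
    (A : Matrix m n ℝ) : ℝ :=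
  ‖(Matrix.toEuclideanLin A).toContinuousLinearMap‖

/-- The spectral radius (largest modulus of a complex eigenvalue) of a real square matrix. -/
def matrixSpectralRadius {n : Type*} [Fintype n] [DecidableEq n]
    (A : Matrix n n ℝ) : ENNReal :=
  spectralRadius ℂ (A.map Complex.ofReal)

/-- The set of `t`-fold products of members of `S`. -/
def productSet {n : Type*} [Fintype n] [DecidableEq n]
    (S : Set (Matrix n n ℝ)) (t : ℕ) : Set (Matrix n n ℝ) :=
  {B | ∃ M : Fin t → Matrix n n ℝ, (∀ s, M s ∈ S) ∧ (List.ofFn M).prod = B}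

/-- The joint spectral radius `limsup_t sup_{B ∈ S^t} ρ(B)^(1/t)`. -/
def jointSpectralRadius {n : Type*} [Fintype n] [DecidableEq n]
    (S : Set (Matrix n n ℝ)) : ENNReal :=
  limsup (fun t : ℕ => ⨆ B ∈ productSet S t, matrixSpectralRadius B ^ (1 / (t : ℝ))) atTop

/-- The column span of a matrix. -/
def colSpan {p r : ℕ} (A : Matrix (Fin p) (Fin r) ℝ) : Submodule ℝ (Fin p → ℝ) :=
  Submodule.span ℝ (Set.range A.col)

/-- The matrix `[I_m ; 0]` of size `p × m`. -/
def firstColumns (p m : ℕ) : Matrix (Fin p) (Fin m) ℝ :=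
  Matrix.of fun i j => if (i : ℕ) = (j : ℕ) then 1 else 0

/-- Index set of the `k - 1` stacked blocks of size `p`. -/
abbrev LagIndex (p k : ℕ) : Type := Fin (k - 1) × Fin p

/-- Index set of `(z, ζ) ∈ ℝ^p × ℝ^{p(k-1)}`. -/
abbrev StateIndex (p k : ℕ) : Type := Fin p ⊕ LagIndex p k

/-- Index set of `ℝ^r × ℝ^{p(k-1)}`. -/
abbrev ErrorIndex (p k r : ℕ) : Type := Fin r ⊕ LagIndex p k

/-- The block matrix `E = [I_p ; 0]` of size `p(k-1) × p`. -/
def blockE (p k : ℕ) : Matrix (LagIndex p k) (Fin p) ℝ :=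
  Matrix.of fun x b => if (x.1 : ℕ) = 0 ∧ x.2 = b then 1 else 0

/-- The block matrix `D` with `-I_p` on the diagonal and `I_p` on the first superdiagonal. -/
def blockD (p k : ℕ) : Matrix (LagIndex p k) (LagIndex p k) ℝ :=
  Matrix.of fun x y =>
    if x.2 = y.2 then
      if y.1 = x.1 then -1 else if (y.1 : ℕ) = (x.1 : ℕ) + 1 then 1 else 0
    else 0

/-- The matrix `D₀ = [0, 0; 0, D]`. -/
def boldD0 (p k r : ℕ) : Matrix (ErrorIndex p k r) (StateIndex p k) ℝ :=
  Matrix.fromBlocks 0 0 0 (blockD p k)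

/-- The matrix `[α, Eᵀ; 0, I]`. -/
def boldAlpha {p r : ℕ} (k : ℕ) (α : Matrix (Fin p) (Fin r) ℝ) :
    Matrix (StateIndex p k) (ErrorIndex p k r) ℝ :=
  Matrix.fromBlocks α (blockE p k).transpose 0 1

namespace NonlinearVAR

variable {p k r : ℕ}

/-- `g_j(z) = -∑_{i=j+1}^k f_i(z)`. -/
def g (M : NonlinearVAR p k) (j : ℕ) (z : Fin p → ℝ) : Fin p → ℝ :=
  -∑ i ∈ Finset.Icc (j + 1) k, M.f i z

/-- `π(z) = -f_0(z) + ∑_{i=1}^k f_i(z)`. -/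
def π (M : NonlinearVAR p k) (z : Fin p → ℝ) : Fin p → ℝ :=
  -M.f 0 z + ∑ i ∈ Finset.Icc 1 k, M.f i z

/-- The inverse of `f_0` (used only when `f_0` is bijective). -/
def f0inv (M : NonlinearVAR p k) : (Fin p → ℝ) → (Fin p → ℝ) :=
  Function.invFun (M.f 0)

/-- The stacked map `(θ(z), g_1(z), ..., g_{k-1}(z))`. -/
def boldTheta (M : NonlinearVAR p k) (θ : (Fin p → ℝ) → (Fin r → ℝ)) (z : Fin p → ℝ) :
    ErrorIndex p k r → ℝ :=
  Sum.elim (θ z) (fun x => M.g ((x.1 : ℕ) + 1) z x.2)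

/-- Membership of the class `CVAR_r(α, b, ρ)`. -/
structure InCVAR (M : NonlinearVAR p k) (α : Matrix (Fin p) (Fin r) ℝ) (b ρ : ℝ) : Prop where
  rank_eq : α.rank = r
  rho_nonneg : 0 ≤ ρ
  rho_lt_one : ρ < 1
  homeo : IsHomeomorph (M.f 0)
  exists_decomposition : ∃ (μ : Fin r → ℝ) (θ : (Fin p → ℝ) → (Fin r → ℝ)),
    M.c = α.mulVec μ ∧ (∀ z, M.π z = α.mulVec (θ z)) ∧
    ∃ B : Set (Matrix (StateIndex p k) (ErrorIndex p k r) ℝ),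
      IsClosed B ∧ (∀ β ∈ B, inducedNorm β ≤ b) ∧
      (∀ (z z' : Fin p → ℝ) (ζ ζ' : LagIndex p k → ℝ), ∃ β ∈ B,
        (M.boldTheta θ (M.f0inv z) + (boldD0 p k r).mulVec (Sum.elim z ζ))
          - (M.boldTheta θ (M.f0inv z') + (boldD0 p k r).mulVec (Sum.elim z' ζ'))
          = β.transpose.mulVec (Sum.elim z ζ - Sum.elim z' ζ')) ∧
      jointSpectralRadius {A | ∃ β ∈ B, A = 1 + β.transpose * boldAlpha k α} ≤ ENNReal.ofReal ρ

/-- The path of the model, `path u ς n` being the value at time `τ - k + n`: the values at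
times `τ - 1, ..., τ - k` are `ς 0, ..., ς (k - 1)`, the shock at time `τ` is `u`, and all later
shocks vanish. -/
def path (M : NonlinearVAR p k) (u : Fin p → ℝ) (ς : Fin k → Fin p → ℝ) (n : ℕ) : Fin p → ℝ :=
  if h : n < k then ς (Fin.rev ⟨n, h⟩)
  else M.f0inv (M.c + ∑ i : Fin k, M.f ((i : ℕ) + 1) (path M u ς (n - ((i : ℕ) + 1)))
    + if n = k then u else 0)
termination_by n
decreasing_by have := i.isLt; omega

/-- The path solves the model equation from time `τ` on. -/
theorem path_spec (M : NonlinearVAR p k) (hf : IsHomeomorph (M.f 0)) (u : Fin p → ℝ)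
    (ς : Fin k → Fin p → ℝ) (n : ℕ) (hn : k ≤ n) :
    M.f 0 (M.path u ς n) = M.c + ∑ i : Fin k, M.f ((i : ℕ) + 1) (M.path u ς (n - ((i : ℕ) + 1)))
      + if n = k then u else 0 := by
  rw [path, dif_neg (not_lt.mpr hn)]
  exact Function.rightInverse_invFun hf.surjective _

/-- `response u ς h` is `z_{τ+h}(u; ς)`. -/
def response (M : NonlinearVAR p k) (u : Fin p → ℝ) (ς : Fin k → Fin p → ℝ) (h : ℕ) :
    Fin p → ℝ :=
  M.path u ς (k + h)

/-- `z_∞(u; ς) = lim_{t → ∞} z_t(u; ς)`. -/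
def zInfty (M : NonlinearVAR p k) (u : Fin p → ℝ) (ς : Fin k → Fin p → ℝ) : Fin p → ℝ :=
  limUnder atTop (M.response u ς)

/-- From the state `ς`, the effect of the shock `u` on `z_t` vanishes as `t → ∞`. -/
def NoPermanentEffect (M : NonlinearVAR p k) (ς : Fin k → Fin p → ℝ) (u : Fin p → ℝ) : Prop :=
  Tendsto (fun h => M.response u ς h - M.response 0 ς h) atTop (𝓝 0)

end NonlinearVAR

end

/-! Put x_t = (f_0(z_t), ζ_t), where ζ_t stacks sums of lagged `g` terms. After impact the model
reads x_{t+1} = x_t + a F(x_t), with a = `boldAlpha k α` and F = `errorMap` (`companionState_succ`).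
Since F(x) - F(y) = βᵀ(x - y) with β ∈ B, the errors obey F(x_{t+1}) = (1 + βᵀa) F(x_t). A joint
spectral radius below one makes them decay geometrically, so x_t converges to a zero X of F, and X -
x_τ lies in the range of a (`IsErrorCorrecting.exists_tendsto`).

A shock u moves x_τ by (u, 0), which is in the range of a iff u ∈ span α. If it is, the two orbits
differ by a η_t, where η_t is again driven by matrices 1 + βᵀa, and they merge
(`IsErrorCorrecting.tendsto_sub_zero`). Conversely, equal limits of z_t force equal limits of x_t,
because F vanishes there and D is injective; then (u, 0) is a difference of two displacements in the
range of a.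

The analytic core is that a joint spectral radius defined by eigenvalues controls norms of products:
the Berger–Wang theorem, in the form `decayInDimension`. It goes by induction on the dimension.
After normalizing the growth rate, either all products are bounded, and a pigeonhole argument gives
decay, or the vectors with bounded orbits form a proper nonzero invariant subspace, and the
operators are block triangular. -/

noncomputable section

/-! ### Berger–Wang theorem: small eigenvalues of long products force exponential decay. -/

section JointGrowth

section Words

variable {ι E : Type*} [NormedAddCommGroup E] [InnerProductSpace ℂ E]

/-- The product of the operators `A i` along a word of indices. -/
def wordProd (A : ι → E →L[ℂ] E) (w : List ι) : E →L[ℂ] E := (w.map A).prod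

/-- All products along words of length `n` are bounded by a multiple of `c ^ n`. -/
def HasGrowth (A : ι → E →L[ℂ] E) (c : ℝ) : Prop :=
  ∃ C : ℝ, ∀ w : List ι, ‖wordProd A w‖ ≤ C * c ^ w.length

/-- All eigenvalues have modulus at most `1 / 2`. -/
def SmallEigenvalues (B : E →L[ℂ] E) : Prop :=
  ∀ (l : ℂ) (x : E), x ≠ 0 → B x = l • x → ‖l‖ ≤ 1 / 2

@[simp] theorem wordProd_nil (A : ι → E →L[ℂ] E) : wordProd A [] = 1 := rfl

theorem wordProd_cons (A : ι → E →L[ℂ] E) (i : ι) (w : List ι) :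
    wordProd A (i :: w) = A i * wordProd A w := by simp [wordProd]

theorem wordProd_append (A : ι → E →L[ℂ] E) (v w : List ι) :
    wordProd A (v ++ w) = wordProd A v * wordProd A w := by simp [wordProd]

theorem wordProd_smul (A : ι → E →L[ℂ] E) (s : ℂ) (w : List ι) :
    wordProd (fun i => s • A i) w = s ^ w.length • wordProd A w := by
  induction w with
  | nil => simp
  | cons i w ih =>
    rw [wordProd_cons, wordProd_cons, ih, List.length_cons, smul_mul_smul_comm, pow_succ']

theorem norm_wordProd_le (A : ι → E →L[ℂ] E) {K : ℝ} (hK : ∀ i, ‖A i‖ ≤ K) (w : List ι) :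
    ‖wordProd A w‖ ≤ K ^ w.length := by
  induction w with
  | nil =>
    rw [List.length_nil, pow_zero]
    exact ContinuousLinearMap.norm_id_le
  | cons i w ih =>
    rw [wordProd_cons, List.length_cons, pow_succ']
    exact (norm_mul_le _ _).trans
      (mul_le_mul (hK i) ih (norm_nonneg _) ((norm_nonneg _).trans (hK i)))

theorem HasGrowth.mono {A : ι → E →L[ℂ] E} {c d : ℝ} (hc : 0 ≤ c) (hcd : c ≤ d)
    (h : HasGrowth A c) : HasGrowth A d := by
  obtain ⟨C, hC⟩ := h
  refine ⟨|C|, fun w => (hC w).trans ?_⟩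
  gcongr
  exact le_abs_self C

/-- Each block of length `t` split off a word gains 1/2 = c ^ t. The remainder is shorter than `t`,
so c to its length is at least 1/2, which the factor 2 in the constant absorbs. -/
theorem hasGrowth_of_forall_norm_le_half (A : ι → E →L[ℂ] E) {K : ℝ} (hK : ∀ i, ‖A i‖ ≤ K)
    {t : ℕ} (ht : 1 ≤ t) (h : ∀ w : List ι, w.length = t → ‖wordProd A w‖ ≤ 1 / 2) :
    ∃ c, 0 ≤ c ∧ c < 1 ∧ HasGrowth A c := by
  have ht0 : (t : ℝ) ≠ 0 := by positivity
  set c : ℝ := (1 / 2 : ℝ) ^ (1 / (t : ℝ)) with hc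
  have hc0 : 0 ≤ c := by positivity
  have hct : c ^ t = 1 / 2 := by
    rw [hc, ← Real.rpow_natCast, ← Real.rpow_mul (by norm_num)]
    simp [ht0]
  have hc1 : c < 1 := Real.rpow_lt_one (by norm_num) (by norm_num) (by positivity)
  set K' := max K 1
  have hK' : ∀ i, ‖A i‖ ≤ K' := fun i => (hK i).trans (le_max_left _ _)
  have hK1 : 1 ≤ K' := le_max_right _ _
  refine ⟨c, hc0, hc1, 2 * K' ^ t, fun w => ?_⟩
  induction hn : w.length using Nat.strong_induction_on generalizing w with
  | _ n ih =>
    rcases lt_or_ge n t with hlt | hge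
    · have h1 : ‖wordProd A w‖ ≤ K' ^ t := by
        refine (norm_wordProd_le A hK' w).trans ?_
        rw [hn]
        exact pow_le_pow_right₀ hK1 hlt.le
      have h2 : 1 / 2 ≤ c ^ n := hct ▸ pow_le_pow_of_le_one hc0 hc1.le hlt.le
      have h3 : 0 ≤ K' ^ t := by positivity
      nlinarith
    · have hw := wordProd_append A (w.take t) (w.drop t)
      rw [List.take_append_drop] at hw
      have h1 := h (w.take t) (by simp; omega)
      have h2 := ih (n - t) (by omega) (w.drop t) (by simp; omega)
      rw [hw]
      refine (norm_mul_le _ _).trans ?_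
      calc _ ≤ 1 / 2 * (2 * K' ^ t * c ^ (n - t)) := by gcongr
        _ = 2 * K' ^ t * c ^ n := by
          rw [← hct]
          nth_rewrite 2 [← Nat.sub_add_cancel hge]
          rw [pow_add]; ring

theorem SmallEigenvalues.smul {B : E →L[ℂ] E} (h : SmallEigenvalues B) {s : ℂ}
    (hs : ‖s‖ ≤ 1) : SmallEigenvalues (s • B) := by
  intro l x hx hB
  rcases eq_or_ne s 0 with rfl | h0
  · have : l = 0 := by simpa [hx, eq_comm] using hB
    simp [this]
  · have := h (s⁻¹ * l) x hx (by
      rw [mul_smul, ← hB]; simp [smul_smul, inv_mul_cancel₀ h0])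
    rw [norm_mul, norm_inv, inv_mul_le_iff₀ (norm_pos_iff.2 h0)] at this
    nlinarith

/-- The determinant is the product of the factors 1 - λ, each of modulus at least 1/2. Unlike the
eigenvalue condition, this bound is visibly closed in `B`, as needed for compactness. -/
theorem SmallEigenvalues.le_norm_det [FiniteDimensional ℂ E] {B : E →L[ℂ] E}
    (h : SmallEigenvalues B) :
    (1 / 2 : ℝ) ^ Module.finrank ℂ E ≤ ‖(1 - B).det‖ := by
  have hs := IsAlgClosed.splits (LinearMap.charpoly (B : E →ₗ[ℂ] E))
  have h1 : (1 - B).det = (LinearMap.charpoly (B : E →ₗ[ℂ] E)).eval 1 := by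
    rw [LinearMap.eval_charpoly, map_one]; rfl
  rw [h1, hs.eval_eq_prod_roots_of_monic (LinearMap.charpoly_monic _)]
  have hcard := hs.natDegree_eq_card_roots
  rw [LinearMap.charpoly_natDegree] at hcard
  rw [hcard]
  have key : ∀ m : Multiset ℂ, (∀ l ∈ m, ‖l‖ ≤ 1 / 2) →
      (1 / 2 : ℝ) ^ m.card ≤ ‖(m.map (fun a => 1 - a)).prod‖ := by
    intro m
    induction m using Multiset.induction with
    | empty => simp
    | cons a m ih =>
      intro hm
      rw [Multiset.card_cons, Multiset.map_cons, Multiset.prod_cons, norm_mul, pow_succ']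
      have ha := hm a (Multiset.mem_cons_self a m)
      have h2 := ih fun l hl => hm l (Multiset.mem_cons_of_mem hl)
      have h3 : (1 / 2 : ℝ) ≤ ‖1 - a‖ := by
        have := norm_sub_norm_le (1 : ℂ) a
        rw [norm_one] at this
        linarith
      gcongr
  refine key _ fun l hl => ?_
  have hr := Polynomial.isRoot_of_mem_roots hl
  obtain ⟨x, hx⟩ := ((Module.End.hasEigenvalue_iff_isRoot_charpoly _ l).2 hr).exists_hasEigenvector
  exact h l x hx.2 hx.apply_eq_smul

/-- A long product of norm above 1/2 keeps some orbit in a compact shell, where two far-apart times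
nearly coincide. The product between them then almost fixes a vector, although 1 is uniformly far
from its eigenvalues. -/
theorem exists_norm_wordProd_le_half_of_bounded [FiniteDimensional ℂ E] (A : ι → E →L[ℂ] E)
    {C : ℝ} (hC : ∀ w, ‖wordProd A w‖ ≤ C) {T : ℕ} (hT1 : 1 ≤ T)
    (hT : ∀ w : List ι, T ≤ w.length → SmallEigenvalues (wordProd A w)) :
    ∃ t, 1 ≤ t ∧ ∀ w : List ι, w.length = t → ‖wordProd A w‖ ≤ 1 / 2 := by
  by_contra! hcon
  have hC0 : 0 ≤ C := (norm_nonneg _).trans (hC [])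
  set R := max C 1
  have hR : ∀ w, ‖wordProd A w‖ ≤ R := fun w => (hC w).trans (le_max_left _ _)
  have hR1 : 1 ≤ R := le_max_right _ _
  have hRp : 0 < R := by linarith
  -- a uniform lower bound for `‖B x - x‖`
  obtain ⟨e, he, hmin⟩ : ∃ e > 0, ∀ B : E →L[ℂ] E, ‖B‖ ≤ R → SmallEigenvalues B →
      ∀ x : E, 1 / (2 * R) ≤ ‖x‖ → ‖x‖ ≤ R → e ≤ ‖B x - x‖ := by
    let S : Set ((E →L[ℂ] E) × E) :=
      (Metric.closedBall 0 R ∩ {B | (1 / 2 : ℝ) ^ Module.finrank ℂ E ≤ ‖(1 - B).det‖}) ×ˢ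
        (Metric.closedBall 0 R ∩ {x | 1 / (2 * R) ≤ ‖x‖})
    have : ProperSpace (E →L[ℂ] E) := FiniteDimensional.proper ℂ _
    have : ProperSpace E := FiniteDimensional.proper ℂ _
    have hS : IsCompact S := by
      refine ((isCompact_closedBall _ _).inter_right ?_).prod
        ((isCompact_closedBall _ _).inter_right ?_)
      · exact isClosed_le continuous_const
          (ContinuousLinearMap.continuous_det.comp (continuous_const.sub continuous_id)).norm
      · exact isClosed_le continuous_const continuous_norm
    have hcont : Continuous fun q : (E →L[ℂ] E) × E => ‖q.1 q.2 - q.2‖ := by fun_prop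
    rcases S.eq_empty_or_nonempty with hemp | hne
    · refine ⟨1, one_pos, fun B hB hsm x hx hx' => ?_⟩
      have : (B, x) ∈ S := ⟨⟨by simpa using hB, hsm.le_norm_det⟩, ⟨by simpa using hx', hx⟩⟩
      simp [hemp] at this
    · obtain ⟨q, hq, hqmin⟩ := hS.exists_isMinOn hne hcont.continuousOn
      refine ⟨‖q.1 q.2 - q.2‖, ?_, fun B hB hsm x hx hx' => ?_⟩
      · rw [gt_iff_lt, norm_pos_iff]
        intro h0
        have hdet : (1 - q.1).det ≠ 0 := by
          intro hd
          have := hq.1.2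
          simp only [Set.mem_ofPred_eq, hd, norm_zero] at this
          exact absurd this (not_le.2 (by positivity))
        have hx0 : q.2 = 0 := by
          have hker := LinearMap.ker_eq_bot.1
            ((LinearMap.det_eq_zero_iff_ker_ne_bot
              (f := ((1 - q.1 : E →L[ℂ] E) : E →ₗ[ℂ] E))).not_left.1 hdet)
          apply hker
          have : q.2 - q.1 q.2 = 0 := by rw [← neg_sub, h0, neg_zero]
          simpa using this
        have h2 := hq.2.2
        simp only [Set.mem_ofPred_eq, hx0, norm_zero] at h2
        exact absurd h2 (not_le.2 (by positivity))
      · exact hqmin (a := (B, x)) ⟨⟨by simpa using hB, hsm.le_norm_det⟩, ⟨by simpa using hx', hx⟩⟩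
  -- pigeonhole along a long orbit
  have : ProperSpace E := FiniteDimensional.proper ℂ _
  obtain ⟨F, -, hFfin, hF⟩ := (isCompact_closedBall (0 : E) R).finite_cover_balls
    (half_pos he)
  set N := hFfin.toFinset.card
  obtain ⟨w, hw, hwn⟩ := hcon ((N + 1) * T) (by nlinarith)
  obtain ⟨x, hx1, hx⟩ : ∃ x : E, ‖x‖ ≤ 1 ∧ 1 / 2 < ‖wordProd A w x‖ := by
    by_contra! hall
    refine absurd (ContinuousLinearMap.opNorm_le_of_unit_norm (by norm_num) ?_) (not_le.2 hwn)
    exact fun x hx => hall x hx.le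
  -- The rightmost letters act first, so `y s` is the image of `x` after `s * T` letters.
  let y : ℕ → E := fun s => wordProd A (w.drop ((N + 1) * T - s * T)) x
  have hyR : ∀ s, ‖y s‖ ≤ R := fun s =>
    ((wordProd A _).le_opNorm x).trans (by nlinarith [hR (w.drop ((N + 1) * T - s * T)), norm_nonneg x])
  have hyl : ∀ s, 1 / (2 * R) ≤ ‖y s‖ := by
    intro s
    have h1 : wordProd A w x = wordProd A (w.take ((N + 1) * T - s * T)) (y s) := by
      conv_lhs => rw [← List.take_append_drop ((N + 1) * T - s * T) w, wordProd_append]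
      rfl
    have h2 := (wordProd A (w.take ((N + 1) * T - s * T))).le_opNorm (y s)
    rw [← h1] at h2
    have h3 := hR (w.take ((N + 1) * T - s * T))
    rw [div_le_iff₀ (by positivity)]
    nlinarith [norm_nonneg (y s)]
  have hcen : ∀ s, ∃ z ∈ F, y s ∈ Metric.ball z (e / 2) := by
    intro s
    simpa using hF (show y s ∈ Metric.closedBall (0 : E) R by simpa using hyR s)
  choose z hzF hz using hcen
  obtain ⟨a, ha, b, hb, hab, hzab⟩ := Finset.exists_ne_map_eq_of_card_lt_of_maps_to
    (s := Finset.range (N + 1)) (t := hFfin.toFinset) (f := z) (by simp [N])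
    (fun s _ => by simpa using hzF s)
  have main : ∀ a b : ℕ, a < b → b ≤ N + 1 → z a = z b → False := by
    intro a b hab hb hzab
    have hle : b * T ≤ (N + 1) * T := Nat.mul_le_mul_right _ hb
    have hlt : a * T + T ≤ b * T := by nlinarith
    -- The segment leading from `y a` to `y b` has length at least `T`, so its eigenvalues are
    -- small.
    set v := (w.drop ((N + 1) * T - b * T)).take (b * T - a * T) with hv
    have hyv : y b = wordProd A v (y a) := by
      have : w.drop ((N + 1) * T - b * T) = v ++ w.drop ((N + 1) * T - a * T) := by
        conv_lhs => rw [← List.take_append_drop (b * T - a * T) (w.drop ((N + 1) * T - b * T))]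
        rw [List.drop_drop, hv]
        congr 2
        omega
      simp only [y]
      rw [this, wordProd_append]
      rfl
    have hvl : v.length = b * T - a * T := by simp [hv, hw]; omega
    have h1 := hmin _ (hR v) (hT v (by omega)) (y a) (hyl a) (hyR a)
    rw [← hyv] at h1
    have h2 := hz a
    have h3 := hz b
    rw [hzab] at h2
    have h4 := dist_triangle_right (y b) (y a) (z b)
    rw [dist_eq_norm] at h4
    rw [Metric.mem_ball] at h2 h3
    linarith
  rcases lt_or_gt_of_ne hab with h | h
  · exact main a b h (by simp at hb; omega) hzab
  · exact main b a h (by simp at ha; omega) hzab.symm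

end Words

/-! ### Block-triangular families: restriction to an invariant subspace and action on the quotient.
-/

section Compression

variable {ι : Type*} {E : Type*} [NormedAddCommGroup E] [InnerProductSpace ℂ E]
  [FiniteDimensional ℂ E]

/-- The compressions of the operators `A i` to a subspace. -/
def compress (A : ι → E →L[ℂ] E) (U : Submodule ℂ E) (i : ι) : U →L[ℂ] U :=
  U.orthogonalProjectionOnto ∘L A i ∘L U.subtypeL

theorem compress_apply (A : ι → E →L[ℂ] E) (U : Submodule ℂ E) (i : ι) (x : U) :
    compress A U i x = U.orthogonalProjectionOnto (A i x) := rfl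

theorem orthogonalProjectionOnto_add_orthogonal (U : Submodule ℂ E) (x : E) :
    (U.orthogonalProjectionOnto x : E) + (Uᗮ.orthogonalProjectionOnto x : E) = x :=
  U.starProjection_add_starProjection_orthogonal x

theorem norm_compress_le {A : ι → E →L[ℂ] E} {K : ℝ} (hK : ∀ i, ‖A i‖ ≤ K)
    (U : Submodule ℂ E) (i : ι) : ‖compress A U i‖ ≤ K := by
  refine ContinuousLinearMap.opNorm_le_bound _ ((norm_nonneg _).trans (hK i)) fun x => ?_
  exact (U.norm_orthogonalProjectionOnto_apply_le _).trans ((A i).le_of_opNorm_le (hK i) _)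

variable {A : ι → E →L[ℂ] E} {V : Submodule ℂ E}

theorem coe_wordProd_compress (hV : ∀ i, ∀ x ∈ V, A i x ∈ V) (w : List ι) (x : V) :
    (wordProd (compress A V) w x : E) = wordProd A w x := by
  induction w with
  | nil => rfl
  | cons i w ih =>
    rw [wordProd_cons, wordProd_cons, mul_apply_eq_comp,
      mul_apply_eq_comp, compress_apply, ← ih]
    exact congrArg Subtype.val
      (V.orthogonalProjectionOnto_mem_subspace_eq_self ⟨_, hV i _ (Subtype.property _)⟩)

/-- As `V` is invariant, the compression to `Vᗮ` is a model of the action on the quotient by `V`,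
hence multiplicative along words. -/
theorem wordProd_compress_orthogonal (hV : ∀ i, ∀ x ∈ V, A i x ∈ V) (w : List ι) (x : E) :
    Vᗮ.orthogonalProjectionOnto (wordProd A w x) =
      wordProd (compress A Vᗮ) w (Vᗮ.orthogonalProjectionOnto x) := by
  induction w with
  | nil => rfl
  | cons i w ih =>
    rw [wordProd_cons, wordProd_cons, mul_apply_eq_comp,
      mul_apply_eq_comp, compress_apply, ← ih]
    conv_lhs => rw [← orthogonalProjectionOnto_add_orthogonal V (wordProd A w x), map_add, map_add]
    rw [Submodule.orthogonalProjectionOnto_eq_zero_iff.2, zero_add]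
    rw [Submodule.orthogonal_orthogonal]
    exact hV i _ (Subtype.property _)

theorem smallEigenvalues_compress (hV : ∀ i, ∀ x ∈ V, A i x ∈ V) {w : List ι}
    (h : SmallEigenvalues (wordProd A w)) : SmallEigenvalues (wordProd (compress A V) w) := by
  intro l x hx hl
  refine h l x (by simpa using hx) ?_
  rw [← coe_wordProd_compress hV, hl]; rfl

/-- If `l` is an eigenvalue on the quotient but not of the product W, then W - l is injective, hence
onto, on `V`. Since (W - l) y ∈ V, it equals (W - l) v with v ∈ V, so y = v ∈ V ∩ Vᗮ, forcing y = 0.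
-/
theorem smallEigenvalues_compress_orthogonal (hV : ∀ i, ∀ x ∈ V, A i x ∈ V) {w : List ι}
    (h : SmallEigenvalues (wordProd A w)) :
    SmallEigenvalues (wordProd (compress A Vᗮ) w) := by
  intro l y hy hl
  by_contra hcon
  have h0 : ∀ x, wordProd A w x = l • x → x = 0 := fun x hx => by
    by_contra hx0
    exact hcon (h l x hx0 hx)
  let f : V →ₗ[ℂ] V := (wordProd (compress A V) w : V →ₗ[ℂ] V) - l • 1
  have hfinj : Function.Injective f := by
    rw [injective_iff_map_eq_zero]
    intro v hv
    have : wordProd (compress A V) w v = l • v := sub_eq_zero.1 hv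
    have := congrArg Subtype.val this
    rw [coe_wordProd_compress hV] at this
    exact Subtype.ext (h0 _ this)
  have hmem : wordProd A w y - l • (y : E) ∈ V := by
    refine V.orthogonal_orthogonal.le (Submodule.orthogonalProjectionOnto_eq_zero_iff.1 ?_)
    rw [map_sub, wordProd_compress_orthogonal hV, map_smul,
      Submodule.orthogonalProjectionOnto_mem_subspace_eq_self, hl, sub_self]
  obtain ⟨v, hv⟩ := (LinearMap.injective_iff_surjective.1 hfinj) ⟨_, hmem⟩
  have hv' : wordProd A w v - l • (v : E) = wordProd A w y - l • (y : E) := by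
    have := congrArg Subtype.val hv
    rwa [show ((f v : V) : E) = wordProd (compress A V) w v - l • (v : E) from rfl,
      coe_wordProd_compress hV] at this
  have h1 : (y : E) - v = 0 := h0 _ (by
    rw [sub_eq_sub_iff_add_eq_add] at hv'
    rw [map_sub, smul_sub, sub_eq_sub_iff_add_eq_add, ← hv', add_comm])
  have h2 : (y : E) ∈ V := by
    rw [sub_eq_zero.1 h1]; exact v.2
  have h3 := Submodule.inner_right_of_mem_orthogonal h2 y.2
  exact hy (Subtype.ext (inner_self_eq_zero.1 h3))

/-- In the off-diagonal block a word of length n crosses from `Vᗮ` to `V` at one of n letters. Each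
crossing contributes O(c ^ (n - 1)), and n c ^ n → 0. -/
theorem exists_norm_wordProd_le_half_of_compress {K : ℝ} (hK : ∀ i, ‖A i‖ ≤ K)
    (hV : ∀ i, ∀ x ∈ V, A i x ∈ V) {c : ℝ} (hc0 : 0 < c) (hc1 : c < 1)
    (h1 : HasGrowth (compress A V) c) (h2 : HasGrowth (compress A Vᗮ) c) :
    ∃ t, 1 ≤ t ∧ ∀ w : List ι, w.length = t → ‖wordProd A w‖ ≤ 1 / 2 := by
  rcases isEmpty_or_nonempty ι with hι | ⟨⟨i₀⟩⟩
  · exact ⟨1, le_rfl, fun w hw => by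
      obtain ⟨i, rfl⟩ := List.length_eq_one_iff.1 hw
      exact (hι.false i).elim⟩
  have hK0 : 0 ≤ K := (norm_nonneg _).trans (hK i₀)
  obtain ⟨C1, h1⟩ := h1
  obtain ⟨C2, h2⟩ := h2
  have hC1 : 0 ≤ C1 := by simpa using (norm_nonneg _).trans (h1 [])
  have hC2 : 0 ≤ C2 := by simpa using (norm_nonneg _).trans (h2 [])
  -- `D` absorbs the power of `c` lost at the crossing letter.
  obtain ⟨D, hD⟩ : ∃ D, D * c = K * C2 := ⟨K * C2 / c, by field_simp⟩
  have hW : ∀ (w : List ι) (x : E), ‖Vᗮ.orthogonalProjectionOnto (wordProd A w x)‖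
      ≤ C2 * c ^ w.length * ‖x‖ := by
    intro w x
    rw [wordProd_compress_orthogonal hV]
    refine (ContinuousLinearMap.le_of_opNorm_le _ (h2 w) _).trans ?_
    have := Vᗮ.norm_orthogonalProjectionOnto_apply_le x
    gcongr
  -- The prefix `w'` is kept arbitrary so that the induction can move a letter of `w` into it.
  have key : ∀ (w : List ι) (x : E) (w' : List ι),
      ‖wordProd (compress A V) w' (V.orthogonalProjectionOnto (wordProd A w x))‖ ≤
        C1 * c ^ w'.length * ((1 + w.length * D) * c ^ w.length) * ‖x‖ := by
    intro w x
    induction w with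
    | nil =>
      intro w'
      refine (ContinuousLinearMap.le_of_opNorm_le _ (h1 w') _).trans ?_
      have := V.norm_orthogonalProjectionOnto_apply_le x
      simp only [wordProd_nil, List.length_nil, Nat.cast_zero, zero_mul, add_zero, pow_zero,
        mul_one]
      gcongr
      exact this
    | cons i w ih =>
      intro w'
      have e1 : V.orthogonalProjectionOnto (wordProd A (i :: w) x) =
          compress A V i (V.orthogonalProjectionOnto (wordProd A w x)) +
          V.orthogonalProjectionOnto (A i (Vᗮ.orthogonalProjectionOnto (wordProd A w x))) := by
        rw [compress_apply, ← map_add, ← map_add, orthogonalProjectionOnto_add_orthogonal,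
          wordProd_cons]
        rfl
      have e2 : wordProd (compress A V) w'
          (compress A V i (V.orthogonalProjectionOnto (wordProd A w x))) =
          wordProd (compress A V) (w' ++ [i]) (V.orthogonalProjectionOnto (wordProd A w x)) := by
        rw [wordProd_append, wordProd_cons]; rfl
      rw [e1, map_add, e2]
      refine (norm_add_le _ _).trans ?_
      have b1 := ih (w' ++ [i])
      have b2 := ContinuousLinearMap.le_of_opNorm_le _ (h1 w')
        (V.orthogonalProjectionOnto (A i (Vᗮ.orthogonalProjectionOnto (wordProd A w x))))
      have b3 := (V.norm_orthogonalProjectionOnto_apply_le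
        (A i (Vᗮ.orthogonalProjectionOnto (wordProd A w x)))).trans
        ((A i).le_of_opNorm_le_of_le (hK i) (hW w x))
      have b4 : C1 * c ^ w'.length * ‖V.orthogonalProjectionOnto
          (A i (Vᗮ.orthogonalProjectionOnto (wordProd A w x)))‖ ≤
          C1 * c ^ w'.length * (K * (C2 * c ^ w.length * ‖x‖)) := by gcongr
      refine (add_le_add b1 (b2.trans b4)).trans (le_of_eq ?_)
      simp only [List.length_append, List.length_cons, List.length_nil, Nat.cast_add,
        Nat.cast_one, zero_add, pow_add, pow_one]
      linear_combination (-(C1 * c ^ w'.length * c ^ w.length * ‖x‖)) * hD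
  have hbound : ∀ w, ‖wordProd A w‖ ≤
      C1 * ((1 + w.length * D) * c ^ w.length) + C2 * c ^ w.length := by
    intro w
    have hD0 : 0 ≤ D := by
      have : 0 ≤ D * c := hD ▸ by positivity
      exact nonneg_of_mul_nonneg_left this hc0
    refine ContinuousLinearMap.opNorm_le_bound _ (by positivity) fun x => ?_
    rw [← orthogonalProjectionOnto_add_orthogonal V (wordProd A w x)]
    refine (norm_add_le _ _).trans ?_
    have b1 := key w x []
    simp only [List.length_nil, pow_zero, mul_one, wordProd_nil] at b1
    rw [add_mul]
    exact add_le_add b1 (hW w x)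
  have hlim : Tendsto (fun n : ℕ => C1 * ((1 + n * D) * c ^ n) + C2 * c ^ n) atTop (𝓝 0) := by
    have l1 := tendsto_pow_atTop_nhds_zero_of_lt_one hc0.le hc1
    have l2 := tendsto_self_mul_const_pow_of_lt_one hc0.le hc1
    have := ((l1.const_mul (C1 + C2)).add (l2.const_mul (C1 * D)))
    rw [mul_zero, mul_zero, add_zero] at this
    refine this.congr fun n => ?_
    ring
  obtain ⟨t, ht, ht1⟩ := ((hlim.eventually_le_const (by norm_num : (0 : ℝ) < 1 / 2)).and
    (eventually_ge_atTop 1)).exists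
  exact ⟨t, ht1, fun w hw => (hbound w).trans (hw ▸ ht)⟩

end Compression

universe u v

section Orbits

variable {ι : Type*} {E : Type*} [NormedAddCommGroup E] [InnerProductSpace ℂ E]

/-- The vectors whose images under all products of the operators `A i` stay bounded. -/
def boundedOrbits (A : ι → E →L[ℂ] E) : Submodule ℂ E where
  carrier := {x | ∃ C : ℝ, ∀ w : List ι, ‖wordProd A w x‖ ≤ C}
  zero_mem' := ⟨0, fun w => by simp⟩
  add_mem' := by
    rintro x y ⟨C, hC⟩ ⟨D, hD⟩
    refine ⟨C + D, fun w => ?_⟩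
    rw [map_add]
    exact (norm_add_le _ _).trans (add_le_add (hC w) (hD w))
  smul_mem' := by
    rintro s x ⟨C, hC⟩
    refine ⟨‖s‖ * C, fun w => ?_⟩
    rw [map_smul, norm_smul]
    exact mul_le_mul_of_nonneg_left (hC w) (norm_nonneg _)

theorem mem_boundedOrbits {A : ι → E →L[ℂ] E} {x : E} :
    x ∈ boundedOrbits A ↔ ∃ C : ℝ, ∀ w : List ι, ‖wordProd A w x‖ ≤ C := Iff.rfl

theorem apply_mem_boundedOrbits (A : ι → E →L[ℂ] E) (i : ι) (x : E)
    (hx : x ∈ boundedOrbits A) : A i x ∈ boundedOrbits A := by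
  obtain ⟨C, hC⟩ := hx
  refine ⟨C, fun w => ?_⟩
  have := hC (w ++ [i])
  rwa [wordProd_append, wordProd_cons] at this

/-- Otherwise compactness of the sphere gives `L` such that every vector is at least doubled by some
word of length at most `L`. Iterating contradicts growth at rate `c` with c ^ L = 3/2 < 2. -/
theorem boundedOrbits_ne_bot [FiniteDimensional ℂ E] [Nontrivial E] (A : ι → E →L[ℂ] E)
    (hg : ∀ c, 1 < c → HasGrowth A c) : boundedOrbits A ≠ ⊥ := by
  intro hbot
  have : ProperSpace E := FiniteDimensional.proper ℂ _
  have hex : ∀ x ∈ Metric.sphere (0 : E) 1, ∃ w, 2 < ‖wordProd A w x‖ := by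
    intro x hx
    by_contra! hcon
    have : x ∈ boundedOrbits A := ⟨2, hcon⟩
    rw [hbot, Submodule.mem_bot] at this
    simp [this] at hx
  obtain ⟨F, hF⟩ := (isCompact_sphere (0 : E) 1).elim_finite_subcover
    (fun w : List ι => {x | 2 < ‖wordProd A w x‖})
    (fun w => isOpen_lt continuous_const (wordProd A w).continuous.norm)
    (fun x hx => by
      obtain ⟨w, hw⟩ := hex x hx
      exact Set.mem_iUnion.2 ⟨w, hw⟩)
  set L := F.sup List.length + 1
  have hstep : ∀ x : E, ∃ w : List ι, w.length ≤ L ∧ 2 * ‖x‖ ≤ ‖wordProd A w x‖ := by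
    intro x
    rcases eq_or_ne x 0 with rfl | hx
    · exact ⟨[], by simp, by simp⟩
    have hx' : 0 < ‖x‖ := norm_pos_iff.2 hx
    have hs : ((‖x‖⁻¹ : ℝ) : ℂ) • x ∈ Metric.sphere (0 : E) 1 := by
      simp [norm_smul, hx'.ne']
    obtain ⟨w, hwF, hw⟩ := Set.mem_iUnion₂.1 (hF hs)
    refine ⟨w, (Finset.le_sup (f := List.length) hwF).trans (Nat.le_succ _), ?_⟩
    have hw' : 2 < ‖wordProd A w (((‖x‖⁻¹ : ℝ) : ℂ) • x)‖ := hw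
    rw [map_smul, norm_smul, Complex.norm_real, norm_inv, norm_norm, lt_inv_mul_iff₀ hx'] at hw'
    linarith
  have hiter : ∀ (m : ℕ) (x : E), ∃ w : List ι, w.length ≤ m * L ∧
      2 ^ m * ‖x‖ ≤ ‖wordProd A w x‖ := by
    intro m x
    induction m with
    | zero => exact ⟨[], by simp, by simp⟩
    | succ m ih =>
      obtain ⟨w, hw, hw2⟩ := ih
      obtain ⟨w', hw', hw2'⟩ := hstep (wordProd A w x)
      refine ⟨w' ++ w, by rw [List.length_append]; linarith, ?_⟩
      rw [wordProd_append, mul_apply_eq_comp, pow_succ]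
      linarith
  obtain ⟨x, hx⟩ := exists_ne (0 : E)
  have hx' : 0 < ‖x‖ := norm_pos_iff.2 hx
  set c : ℝ := (3 / 2 : ℝ) ^ (1 / (L : ℝ)) with hc
  have hL : (L : ℝ) ≠ 0 := by positivity
  have hcL : c ^ L = 3 / 2 := by
    rw [hc, ← Real.rpow_natCast, ← Real.rpow_mul (by norm_num)]
    simp [hL]
  have hc1 : 1 < c := Real.one_lt_rpow (by norm_num) (by positivity)
  obtain ⟨C, hC⟩ := hg c hc1
  have hC0 : 0 ≤ C := by simpa using (norm_nonneg _).trans (hC [])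
  have hle : ∀ m : ℕ, (4 / 3 : ℝ) ^ m ≤ C := by
    intro m
    obtain ⟨w, hw, hw2⟩ := hiter m x
    have h1 := (wordProd A w).le_of_opNorm_le (hC w) x
    have h2 : c ^ w.length ≤ (3 / 2) ^ m := by
      rw [← hcL, ← pow_mul, mul_comm L]
      exact pow_le_pow_right₀ hc1.le hw
    have h3 : 2 ^ m * ‖x‖ ≤ C * (3 / 2) ^ m * ‖x‖ := (hw2.trans h1).trans (by gcongr)
    have h4 := le_of_mul_le_mul_right h3 hx'
    rw [← div_le_iff₀ (by positivity), ← div_pow] at h4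
    norm_num at h4 ⊢
    exact h4
  obtain ⟨m, hm⟩ := pow_unbounded_of_one_lt C (by norm_num : (1 : ℝ) < 4 / 3)
  exact absurd (hle m) (not_le.2 hm)

end Orbits

variable {ι : Type v}

/-- The hypotheses of the generalized spectral radius theorem imply exponential decay. -/
def DecayInDimension (ι : Type v) (n : ℕ) : Prop :=
  ∀ (E : Type u) [NormedAddCommGroup E] [InnerProductSpace ℂ E] [FiniteDimensional ℂ E],
    Module.finrank ℂ E = n → ∀ (A : ι → E →L[ℂ] E) (K : ℝ), (∀ i, ‖A i‖ ≤ K) →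
    ∀ T : ℕ, 1 ≤ T → (∀ w : List ι, T ≤ w.length → SmallEigenvalues (wordProd A w)) →
    ∃ c, 0 ≤ c ∧ c < 1 ∧ HasGrowth A c

theorem exists_hasGrowth_lt_one_of_normalized {E : Type u} [NormedAddCommGroup E]
    [InnerProductSpace ℂ E] [FiniteDimensional ℂ E]
    (ih : ∀ m < Module.finrank ℂ E, DecayInDimension.{u, v} ι m)
    (A : ι → E →L[ℂ] E) {K : ℝ} (hK : ∀ i, ‖A i‖ ≤ K) {T : ℕ} (hT1 : 1 ≤ T)
    (hT : ∀ w : List ι, T ≤ w.length → SmallEigenvalues (wordProd A w))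
    (hg : ∀ c, 1 < c → HasGrowth A c) : ∃ c, 0 ≤ c ∧ c < 1 ∧ HasGrowth A c := by
  by_cases htop : boundedOrbits A = ⊤
  · have hbd : ∀ x, ∃ C, ∀ w, ‖wordProd A w x‖ ≤ C := fun x =>
      mem_boundedOrbits.1 (htop ▸ Submodule.mem_top)
    have : CompleteSpace E := FiniteDimensional.complete ℂ E
    obtain ⟨C, hC⟩ := banach_steinhaus hbd
    obtain ⟨t, ht, h⟩ := exists_norm_wordProd_le_half_of_bounded A hC hT1 hT
    exact hasGrowth_of_forall_norm_le_half A hK ht h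
  set V := boundedOrbits A
  have hV : ∀ i, ∀ x ∈ V, A i x ∈ V := fun i x hx => apply_mem_boundedOrbits A i x hx
  have : Nontrivial E := by
    by_contra hE
    rw [not_nontrivial_iff_subsingleton] at hE
    exact htop (Subsingleton.elim _ _)
  have hbot : V ≠ ⊥ := boundedOrbits_ne_bot A hg
  have hdim := V.finrank_add_finrank_orthogonal
  have hVpos : 0 < Module.finrank ℂ V :=
    Nat.pos_of_ne_zero fun h => hbot (Submodule.finrank_eq_zero.1 h)
  have hVlt : Module.finrank ℂ V < Module.finrank ℂ E := Submodule.finrank_lt htop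
  obtain ⟨c1, h10, h11, h1⟩ := ih _ hVlt V rfl (compress A V) K (norm_compress_le hK V) T hT1
    (fun w hw => smallEigenvalues_compress hV (hT w hw))
  obtain ⟨c2, h20, h21, h2⟩ := ih _ (by omega) Vᗮ rfl (compress A Vᗮ) K
    (norm_compress_le hK Vᗮ) T hT1 (fun w hw => smallEigenvalues_compress_orthogonal hV (hT w hw))
  set c := max (1 / 2) (max c1 c2)
  have hc0 : 0 < c := lt_of_lt_of_le (by norm_num) (le_max_left _ _)
  have hc1 : c < 1 := max_lt (by norm_num) (max_lt h11 h21)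
  obtain ⟨t, ht, h⟩ := exists_norm_wordProd_le_half_of_compress hK hV hc0 hc1
    (h1.mono h10 ((le_max_left _ _).trans (le_max_right _ _)))
    (h2.mono h20 ((le_max_right _ _).trans (le_max_right _ _)))
  exact hasGrowth_of_forall_norm_le_half A hK ht h

/-- Without decay, the infimum `σ` of the growth rates is at least 1, so dividing by it preserves
the eigenvalue bound. The infimum need not be attained, but the rescaled family grows at every rate
above 1. The normalized case then yields a rate below 1, contradicting minimality of `σ`. -/
theorem decayInDimension (n : ℕ) : DecayInDimension.{u, v} ι n := by
  induction n using Nat.strong_induction_on with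
  | _ n ih =>
  intro E _ _ _ hn A K hK T hT1 hT
  subst hn
  by_cases hlt : ∃ c, 0 ≤ c ∧ c < 1 ∧ HasGrowth A c
  · exact hlt
  exfalso
  set S : Set ℝ := {c | 0 ≤ c ∧ HasGrowth A c}
  have hSne : S.Nonempty := ⟨max K 1, zero_le_one.trans (le_max_right _ _), 1, fun w => by
    rw [one_mul]
    exact norm_wordProd_le A (fun i => (hK i).trans (le_max_left _ _)) w⟩
  have hSbd : BddBelow S := ⟨0, fun c hc => hc.1⟩
  set σ := sInf S
  have hσ1 : 1 ≤ σ := le_csInf hSne fun c hc => not_lt.1 fun h => hlt ⟨c, hc.1, h, hc.2⟩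
  have hσ0 : 0 < σ := zero_lt_one.trans_le hσ1
  set s : ℂ := ((σ⁻¹ : ℝ) : ℂ)
  have hsn : ‖s‖ = σ⁻¹ := by simp [s, hσ0.le]
  have hs1 : ‖s‖ ≤ 1 := by rw [hsn]; exact inv_le_one_of_one_le₀ hσ1
  have hnorm : ∀ w, ‖wordProd (fun i => s • A i) w‖ = σ⁻¹ ^ w.length * ‖wordProd A w‖ := by
    intro w
    rw [wordProd_smul, norm_smul, norm_pow, hsn]
  have hscale : ∀ c, HasGrowth (fun i => s • A i) c ↔ HasGrowth A (σ * c) := by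
    intro c
    refine exists_congr fun C => forall_congr' fun w => ?_
    rw [hnorm, inv_pow, inv_mul_le_iff₀ (by positivity), mul_pow, mul_left_comm]
  obtain ⟨c, hc0, hc1, hc⟩ := exists_hasGrowth_lt_one_of_normalized ih (fun i => s • A i) (K := K)
    (fun i => by
      rw [norm_smul]
      exact (mul_le_of_le_one_left (norm_nonneg _) hs1).trans (hK i)) hT1
    (fun w hw => by
      rw [wordProd_smul]
      exact (hT w hw).smul (by rw [norm_pow]; exact pow_le_one₀ (norm_nonneg _) hs1))
    (fun c hc => by
      obtain ⟨d, hd, hdc⟩ := exists_lt_of_csInf_lt hSne (show σ < σ * c by nlinarith)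
      exact (hscale c).2 (hd.2.mono hd.1 hdc.le))
  have : σ ≤ σ * c := csInf_le hSbd ⟨by positivity, (hscale c).1 hc⟩
  nlinarith

end JointGrowth

/-! ### From the joint spectral radius of real matrices to decay of trajectories. -/

section MatrixDecay

variable {n : Type*} [Fintype n] [DecidableEq n]

/-- A real matrix as an operator on complex Euclidean space. -/
def complexOperator (M : Matrix n n ℝ) : EuclideanSpace ℂ n →L[ℂ] EuclideanSpace ℂ n :=
  Matrix.toEuclideanCLM (n := n) (𝕜 := ℂ) (M.map Complex.ofReal)

theorem complexOperator_mul (M N : Matrix n n ℝ) :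
    complexOperator (M * N) = complexOperator M * complexOperator N := by
  rw [complexOperator, complexOperator, complexOperator, ← map_mul]
  congr 1
  exact map_mul (Complex.ofRealHom.mapMatrix (m := n)) M N

theorem complexOperator_one : complexOperator (1 : Matrix n n ℝ) = 1 := by
  rw [complexOperator, ← map_one (Matrix.toEuclideanCLM (n := n) (𝕜 := ℂ))]
  congr 1
  exact map_one (Complex.ofRealHom.mapMatrix (m := n))

theorem complexOperator_toLp (M : Matrix n n ℝ) (x : n → ℝ) :
    complexOperator M (WithLp.toLp 2 fun i => (x i : ℂ)) =
      WithLp.toLp 2 fun i => ((M.mulVec x i : ℝ) : ℂ) := by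
  rw [complexOperator, Matrix.toEuclideanCLM_toLp]
  congr 1
  ext i
  simp [Matrix.mulVec, dotProduct]

theorem wordProd_complexOperator (S : Set (Matrix n n ℝ)) (w : List S) :
    wordProd (fun M : S => complexOperator M.1) w =
      complexOperator (w.map Subtype.val).prod := by
  induction w with
  | nil => simp [complexOperator_one]
  | cons M w ih => rw [wordProd_cons, ih, ← complexOperator_mul, List.map_cons, List.prod_cons]

theorem exists_norm_complexOperator_le (K : ℝ) :
    ∃ C : ℝ, ∀ M : Matrix n n ℝ, (∀ i j, |M i j| ≤ K) → ‖complexOperator M‖ ≤ C := by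
  have hcont : Continuous fun M : Matrix n n ℝ => ‖complexOperator M‖ := by
    refine Continuous.norm (Continuous.comp (g := Matrix.toEuclideanCLM (n := n) (𝕜 := ℂ)) ?_ ?_)
    · exact LinearMap.continuous_of_finiteDimensional
        ((Matrix.toEuclideanCLM (n := n) (𝕜 := ℂ)).toAlgEquiv.toLinearMap)
    · exact continuous_id.matrix_map Complex.continuous_ofReal
  have hcpt : IsCompact (Set.pi Set.univ fun _ : n => Set.pi Set.univ fun _ : n =>
      Set.Icc (-K) K) := isCompact_univ_pi fun _ => isCompact_univ_pi fun _ => isCompact_Icc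
  obtain ⟨C, hC⟩ := (hcpt.image hcont).bddAbove
  exact ⟨C, fun M hM => hC ⟨M, fun i _ j _ => abs_le.1 (hM i j), rfl⟩⟩

theorem smallEigenvalues_complexOperator {M : Matrix n n ℝ}
    (h : matrixSpectralRadius M ≤ 1 / 2) : SmallEigenvalues (complexOperator M) := by
  intro l x hx hl
  have hmem : l ∈ spectrum ℂ (M.map Complex.ofReal) := by
    rw [← AlgEquiv.spectrum_eq (Matrix.toEuclideanCLM (n := n) (𝕜 := ℂ)).toAlgEquiv]
    rw [spectrum.mem_iff]
    intro hu
    obtain ⟨u, hu⟩ := hu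
    have h1 : (algebraMap ℂ _ l - complexOperator M) x = 0 := by
      rw [sub_apply, hl, Algebra.algebraMap_eq_smul_one]
      simp
    have h2 : (u : EuclideanSpace ℂ n →L[ℂ] EuclideanSpace ℂ n) x = 0 := by rw [hu]; exact h1
    have h3 := congrArg (fun f : EuclideanSpace ℂ n →L[ℂ] EuclideanSpace ℂ n => f x) u.inv_mul
    simp only [mul_apply_eq_comp, h2, map_zero] at h3
    exact hx h3.symm
  have h1 : (‖l‖₊ : ENNReal) ≤ 1 / 2 := (le_iSup₂ (f := fun k (_ : k ∈ spectrum ℂ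
    (M.map Complex.ofReal)) => (‖k‖₊ : ENNReal)) l hmem).trans h
  have h2 := ENNReal.toReal_mono (by simp) h1
  simpa using h2

theorem exists_smallEigenvalues_of_jointSpectralRadius_lt_one {S : Set (Matrix n n ℝ)}
    (h : jointSpectralRadius S < 1) : ∃ T : ℕ, 1 ≤ T ∧ ∀ w : List S, T ≤ w.length →
      SmallEigenvalues (wordProd (fun M : S => complexOperator M.1) w) := by
  obtain ⟨q, hq, hq1⟩ := exists_between h
  have hev := eventually_lt_of_limsup_lt hq
  have hpow := (ENNReal.tendsto_pow_atTop_nhds_zero_of_lt_one hq1).eventually_le_const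
    (show (0 : ENNReal) < 1 / 2 by simp)
  obtain ⟨T, hT⟩ := eventually_atTop.1 (hev.and hpow)
  -- Length 0 is excluded because there the exponent 1 / 0 is 0 and the root could not be undone.
  refine ⟨max T 1, le_max_right _ _, fun w hw => ?_⟩
  obtain ⟨h1, h2⟩ := hT w.length ((le_max_left _ _).trans hw)
  have hw1 : 1 ≤ w.length := (le_max_right _ _).trans hw
  rw [wordProd_complexOperator]
  apply smallEigenvalues_complexOperator
  set B := (w.map Subtype.val).prod
  have hB : B ∈ productSet S w.length :=
    ⟨fun s => (w.get s).1, fun s => (w.get s).2, by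
      have : (List.ofFn fun s => (w.get s).1) = w.map Subtype.val := by
        rw [List.ofFn_comp' w.get Subtype.val, List.ofFn_get]
      rw [this]⟩
  have h3 : matrixSpectralRadius B ^ (1 / (w.length : ℝ)) ≤ q :=
    (le_iSup₂ (f := fun B (_ : B ∈ productSet S w.length) =>
      matrixSpectralRadius B ^ (1 / (w.length : ℝ))) B hB).trans h1.le
  have h4 := ENNReal.rpow_le_rpow h3 (Nat.cast_nonneg (α := ℝ) w.length)
  rw [← ENNReal.rpow_mul, one_div_mul_cancel (by positivity), ENNReal.rpow_one,
    ENNReal.rpow_natCast] at h4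
  exact h4.trans h2

/-- Trajectories of a bounded set of matrices with joint spectral radius less than one decay
exponentially. -/
theorem exists_norm_le_of_jointSpectralRadius_lt_one {S : Set (Matrix n n ℝ)} {K : ℝ}
    (hK : ∀ M ∈ S, ∀ i j, |M i j| ≤ K) (h : jointSpectralRadius S < 1) (x : ℕ → n → ℝ)
    (hx : ∀ t, ∃ M ∈ S, x (t + 1) = M.mulVec (x t)) :
    ∃ C c : ℝ, 0 ≤ c ∧ c < 1 ∧ ∀ t, ‖x t‖ ≤ C * c ^ t := by
  obtain ⟨K', hK'⟩ := exists_norm_complexOperator_le (n := n) K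
  obtain ⟨T, hT1, hT⟩ := exists_smallEigenvalues_of_jointSpectralRadius_lt_one h
  obtain ⟨c, hc0, hc1, C, hC⟩ := decayInDimension _ (EuclideanSpace ℂ n) rfl
    (fun M : S => complexOperator M.1) K' (fun M => hK' _ (hK M.1 M.2)) T hT1 hT
  set X : ℕ → EuclideanSpace ℂ n := fun t => WithLp.toLp 2 fun i => (x t i : ℂ)
  have hX : ∀ t, ∃ w : List S, w.length = t ∧
      X t = wordProd (fun M : S => complexOperator M.1) w (X 0) := by
    intro t
    induction t with
    | zero => exact ⟨[], rfl, rfl⟩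
    | succ t ih =>
      obtain ⟨w, hw, hXw⟩ := ih
      obtain ⟨M, hM, hMx⟩ := hx t
      refine ⟨⟨M, hM⟩ :: w, by simp [hw], ?_⟩
      rw [wordProd_cons, mul_apply_eq_comp, ← hXw, complexOperator_toLp, ← hMx]
  refine ⟨C * ‖X 0‖, c, hc0, hc1, fun t => ?_⟩
  obtain ⟨w, hw, hXw⟩ := hX t
  have h1 : ‖X t‖ ≤ C * ‖X 0‖ * c ^ t := by
    rw [hXw]
    refine (ContinuousLinearMap.le_of_opNorm_le _ (hC w) _).trans (le_of_eq ?_)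
    rw [hw]; ring
  refine le_trans ?_ h1
  rw [pi_norm_le_iff_of_nonneg (norm_nonneg _)]
  intro i
  have := PiLp.norm_apply_le (X t) i
  simpa [X] using this

theorem abs_apply_le_inducedNorm {m : Type*} [Fintype m] (A : Matrix m n ℝ) (i : m) (j : n) :
    |A i j| ≤ inducedNorm A := by
  have h1 := ((Matrix.toEuclideanLin A).toContinuousLinearMap).le_opNorm
    (EuclideanSpace.single j (1 : ℝ))
  have h2 := PiLp.norm_apply_le
    ((Matrix.toEuclideanLin A).toContinuousLinearMap (EuclideanSpace.single j (1 : ℝ))) i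
  have h3 := h2.trans h1
  simpa [inducedNorm] using h3

end MatrixDecay

/-! ### Abstract error-correcting dynamics x ↦ x + a F(x). -/

section ErrorCorrection

variable {m e : Type*} [Fintype m] [Fintype e]

theorem norm_mulVec_le_of_abs_le {A : Matrix e m ℝ} {b : ℝ} (hA : ∀ i j, |A i j| ≤ b)
    (x : m → ℝ) : ‖A.mulVec x‖ ≤ |b| * Fintype.card m * ‖x‖ := by
  rw [pi_norm_le_iff_of_nonneg (by positivity)]
  intro i
  rw [Matrix.mulVec, dotProduct]
  refine (norm_sum_le _ _).trans ?_
  calc ∑ j, ‖A i j * x j‖ ≤ ∑ _j : m, |b| * ‖x‖ := by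
        refine Finset.sum_le_sum fun j _ => ?_
        rw [norm_mul]
        exact mul_le_mul ((hA i j).trans (le_abs_self b)) (norm_le_pi_norm x j) (norm_nonneg _)
          (abs_nonneg _)
    _ = |b| * Fintype.card m * ‖x‖ := by simp; ring

variable [DecidableEq e]

theorem abs_one_add_transpose_mul_le {β a : Matrix m e ℝ} {b : ℝ} (hβ : ∀ i j, |β i j| ≤ b)
    (i j : e) : |(1 + β.transpose * a : Matrix e e ℝ) i j| ≤ 1 + |b| * ∑ p, ∑ q, |a p q| := by
  rw [Matrix.add_apply, Matrix.mul_apply]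
  refine (abs_add_le _ _).trans (add_le_add ?_ ?_)
  · rw [Matrix.one_apply]; split_ifs <;> simp
  · rw [Finset.mul_sum]
    refine (Finset.abs_sum_le_sum_abs _ _).trans (Finset.sum_le_sum fun p _ => ?_)
    rw [abs_mul, Matrix.transpose_apply]
    exact mul_le_mul ((hβ p i).trans (le_abs_self b))
      (Finset.single_le_sum (f := fun q => |a p q|) (fun _ _ => abs_nonneg _) (Finset.mem_univ j))
      (abs_nonneg _) (abs_nonneg _)

/-- An error-correction map: differences of `F` are given by a bounded set `B` of matrices for
which the error dynamics `1 + βᵀ a` have joint spectral radius less than one. -/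
structure IsErrorCorrecting (F : (m → ℝ) → e → ℝ) (a : Matrix m e ℝ)
    (B : Set (Matrix m e ℝ)) (b : ℝ) : Prop where
  abs_le : ∀ β ∈ B, ∀ i j, |β i j| ≤ b
  exists_sub : ∀ x y, ∃ β ∈ B, F x - F y = β.transpose.mulVec (x - y)
  jsr_lt : jointSpectralRadius {A | ∃ β ∈ B, A = 1 + β.transpose * a} < 1

variable {F : (m → ℝ) → e → ℝ} {a : Matrix m e ℝ} {B : Set (Matrix m e ℝ)} {b : ℝ}

theorem IsErrorCorrecting.exists_norm_le (h : IsErrorCorrecting F a B b) (η : ℕ → e → ℝ)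
    (hη : ∀ t, ∃ β ∈ B, η (t + 1) = η t + β.transpose.mulVec (a.mulVec (η t))) :
    ∃ C c : ℝ, 0 ≤ c ∧ c < 1 ∧ ∀ t, ‖η t‖ ≤ C * c ^ t := by
  refine exists_norm_le_of_jointSpectralRadius_lt_one
    (K := 1 + |b| * ∑ p, ∑ q, |a p q|) ?_ h.jsr_lt η fun t => ?_
  · rintro _ ⟨β, hβ, rfl⟩ i j
    exact abs_one_add_transpose_mul_le (h.abs_le β hβ) i j
  · obtain ⟨β, hβ, he⟩ := hη t
    refine ⟨_, ⟨β, hβ, rfl⟩, ?_⟩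
    rw [he, Matrix.add_mulVec, Matrix.one_mulVec, Matrix.mulVec_mulVec]

theorem IsErrorCorrecting.continuous (h : IsErrorCorrecting F a B b) : Continuous F := by
  refine (LipschitzWith.of_dist_le_mul (K := Real.toNNReal (|b| * Fintype.card m))
    fun x y => ?_).continuous
  obtain ⟨β, hβ, he⟩ := h.exists_sub x y
  rw [dist_eq_norm, dist_eq_norm, he, Real.coe_toNNReal _ (by positivity)]
  exact norm_mulVec_le_of_abs_le (fun i j => h.abs_le β hβ j i) _

theorem tendsto_zero_of_norm_le_geometric {X : Type*} [SeminormedAddCommGroup X] {η : ℕ → X}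
    (h : ∃ C c : ℝ, 0 ≤ c ∧ c < 1 ∧ ∀ t, ‖η t‖ ≤ C * c ^ t) : Tendsto η atTop (𝓝 0) := by
  obtain ⟨C, c, hc0, hc1, hle⟩ := h
  refine squeeze_zero_norm hle ?_
  simpa using (tendsto_pow_atTop_nhds_zero_of_lt_one hc0 hc1).const_mul C

/-- Orbits converge to a zero of the error map, displaced from the starting point by a vector in
the range of `a`. -/
theorem IsErrorCorrecting.exists_tendsto (h : IsErrorCorrecting F a B b) (x : ℕ → m → ℝ)
    (hx : ∀ t, x (t + 1) = x t + a.mulVec (F (x t))) :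
    ∃ X, Tendsto x atTop (𝓝 X) ∧ F X = 0 ∧ ∃ v, X - x 0 = a.mulVec v := by
  have hdec := h.exists_norm_le (fun t => F (x t)) fun t => by
    obtain ⟨β, hβ, he⟩ := h.exists_sub (x (t + 1)) (x t)
    refine ⟨β, hβ, ?_⟩
    rw [← sub_eq_iff_eq_add', he, hx, add_sub_cancel_left]
  have hzero := tendsto_zero_of_norm_le_geometric hdec
  obtain ⟨C, c, hc0, hc1, hle⟩ := hdec
  have hcau : CauchySeq x := by
    obtain ⟨D, hD⟩ : ∃ D : ℝ, 0 ≤ D ∧ ∀ v, ‖a.mulVec v‖ ≤ D * ‖v‖ :=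
      ⟨‖LinearMap.toContinuousLinearMap a.mulVecLin‖, norm_nonneg _, fun v =>
        (LinearMap.toContinuousLinearMap a.mulVecLin).le_opNorm v⟩
    refine cauchySeq_of_le_geometric c (D * C) hc1 fun t => ?_
    rw [dist_comm, dist_eq_norm, hx, add_sub_cancel_left, mul_assoc]
    exact (hD.2 _).trans (mul_le_mul_of_nonneg_left (hle t) hD.1)
  obtain ⟨X, hX⟩ := cauchySeq_tendsto_of_complete hcau
  refine ⟨X, hX, tendsto_nhds_unique ((h.continuous.tendsto X).comp hX) hzero, ?_⟩
  -- Every increment lies in the range of `a`, a closed subspace, so the limiting displacement does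
  -- too.
  have hmem : ∀ t, x t - x 0 ∈ LinearMap.range a.mulVecLin := by
    intro t
    induction t with
    | zero => simp
    | succ t ih =>
      rw [hx, add_sub_right_comm]
      exact add_mem ih ⟨_, rfl⟩
  have hcl : IsClosed (LinearMap.range a.mulVecLin : Set (m → ℝ)) :=
    Submodule.closed_of_finiteDimensional _
  obtain ⟨v, hv⟩ := hcl.mem_of_tendsto (hX.sub_const (x 0)) (Eventually.of_forall hmem)
  exact ⟨v, hv.symm⟩

/-- Orbits whose starting points differ by a vector in the range of `a` merge. -/
theorem IsErrorCorrecting.tendsto_sub_zero (h : IsErrorCorrecting F a B b) (x y : ℕ → m → ℝ)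
    (hx : ∀ t, x (t + 1) = x t + a.mulVec (F (x t)))
    (hy : ∀ t, y (t + 1) = y t + a.mulVec (F (y t))) (v : e → ℝ)
    (hv : x 0 - y 0 = a.mulVec v) : Tendsto (fun t => x t - y t) atTop (𝓝 0) := by
  -- `a` need not be injective; this explicit preimage of x_t - y_t under `a` is the one that obeys
  -- the linear recursion.
  let η : ℕ → e → ℝ := fun t => v + ∑ s ∈ Finset.range t, (F (x s) - F (y s))
  have hη1 : ∀ t, η (t + 1) = η t + (F (x t) - F (y t)) := fun t => by
    simp only [η, Finset.sum_range_succ, add_assoc]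
  have hη : ∀ t, x t - y t = a.mulVec (η t) := by
    intro t
    induction t with
    | zero => simpa [η] using hv
    | succ t ih =>
      rw [hη1, Matrix.mulVec_add, ← ih, Matrix.mulVec_sub, hx, hy]
      abel
  have hlim := tendsto_zero_of_norm_le_geometric (h.exists_norm_le η fun t => by
    obtain ⟨β, hβ, he⟩ := h.exists_sub (x t) (y t)
    exact ⟨β, hβ, by rw [hη1, he, hη]⟩)
  have hcont : Continuous fun v => a.mulVec v := a.mulVecLin.continuous_of_finiteDimensional
  have := (hcont.tendsto 0).comp hlim
  rw [Matrix.mulVec_zero] at this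
  exact this.congr fun t => (hη t).symm

end ErrorCorrection

/-! ### Linear algebra of the block matrices and of the span of α. -/

section BlockMatrices

variable {p k r : ℕ}

theorem blockE_transpose_mulVec (v : LagIndex p k → ℝ) (a : Fin p) :
    (blockE p k).transpose.mulVec v a = if h : 0 < k - 1 then v (⟨0, h⟩, a) else 0 := by
  simp only [Matrix.mulVec, dotProduct, Matrix.transpose_apply, blockE, Matrix.of_apply, ite_mul,
    one_mul, zero_mul]
  split_ifs with h
  · rw [Finset.sum_eq_single (⟨0, h⟩, a)]
    · simp
    · rintro ⟨i, j⟩ - hne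
      rw [if_neg]
      rintro ⟨h1, h2⟩
      exact hne (Prod.ext (Fin.ext h1) h2)
    · simp
  · refine Finset.sum_eq_zero fun x _ => ?_
    have := x.1.2
    omega

theorem blockD_mulVec (v : LagIndex p k → ℝ) (j : Fin (k - 1)) (a : Fin p) :
    (blockD p k).mulVec v (j, a) =
      -v (j, a) + if h : (j : ℕ) + 1 < k - 1 then v (⟨j + 1, h⟩, a) else 0 := by
  simp only [Matrix.mulVec, dotProduct, blockD, Matrix.of_apply]
  rw [Fintype.sum_prod_type]
  have h1 : ∀ i : Fin (k - 1), ∑ b : Fin p, (if a = b then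
      if i = j then -1 else if (i : ℕ) = (j : ℕ) + 1 then 1 else 0 else 0) * v (i, b) =
      (if i = j then -v (i, a) else 0) + if (i : ℕ) = (j : ℕ) + 1 then v (i, a) else 0 := by
    intro i
    rw [Finset.sum_eq_single a (fun b _ hb => by rw [if_neg (Ne.symm hb), zero_mul]) (by simp)]
    by_cases hij : i = j
    · subst hij; simp
    · simp [hij]
  rw [Finset.sum_congr rfl fun i _ => h1 i, Finset.sum_add_distrib, Finset.sum_ite_eq' _ j]
  simp only [Finset.mem_univ, if_true]
  congr 1
  split_ifs with h
  · rw [Finset.sum_eq_single (⟨j + 1, h⟩ : Fin (k - 1))]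
    · simp
    · intro i _ hi
      rw [if_neg]
      exact fun h2 => hi (Fin.ext h2)
    · simp
  · refine Finset.sum_eq_zero fun i _ => ?_
    have := i.2
    rw [if_neg]
    omega

/-- Back substitution from the last block; the induction variable is the distance to it. -/
theorem blockD_mulVec_injective : Function.Injective (blockD p k).mulVec := by
  have key : ∀ v : LagIndex p k → ℝ, (blockD p k).mulVec v = 0 → v = 0 := by
    intro v hv
    have hall : ∀ (n : ℕ) (j : Fin (k - 1)) (a : Fin p), (j : ℕ) + 1 + n = k - 1 →
        v (j, a) = 0 := by
      intro n
      induction n with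
      | zero =>
        intro j a hj
        have h1 := congrFun hv (j, a)
        rw [blockD_mulVec, dif_neg (by omega)] at h1
        simpa using h1
      | succ n ih =>
        intro j a hj
        have h1 := congrFun hv (j, a)
        rw [blockD_mulVec, dif_pos (by omega), ih ⟨j + 1, by omega⟩ a
          (by simp only; omega)] at h1
        simpa using h1
    ext ⟨j, a⟩
    exact hall (k - 1 - (j + 1)) j a (by have := j.2; omega)
  intro v w hvw
  exact sub_eq_zero.1 (key _ (by rw [Matrix.mulVec_sub]; exact sub_eq_zero.2 hvw))

theorem mem_colSpan_iff {α : Matrix (Fin p) (Fin r) ℝ} {u : Fin p → ℝ} :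
    u ∈ colSpan α ↔ ∃ v, α.mulVec v = u := by
  rw [colSpan, ← Matrix.range_mulVecLin]
  rfl

/-- The lower block row [0, I] forces the lag part of the preimage to vanish. -/
theorem boldAlpha_mulVec_eq_elim_zero_iff {α : Matrix (Fin p) (Fin r) ℝ} {u : Fin p → ℝ} :
    (∃ v, Sum.elim u 0 = (boldAlpha k α).mulVec v) ↔ u ∈ colSpan α := by
  rw [mem_colSpan_iff]
  constructor
  · rintro ⟨v, hv⟩
    rw [boldAlpha, Matrix.fromBlocks_mulVec, Sum.elim_eq_iff] at hv
    obtain ⟨h1, h2⟩ := hv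
    rw [Matrix.zero_mulVec, Matrix.one_mulVec, zero_add] at h2
    rw [← h2, Matrix.mulVec_zero, add_zero] at h1
    exact ⟨_, h1.symm⟩
  · rintro ⟨v, rfl⟩
    refine ⟨Sum.elim v 0, ?_⟩
    rw [boldAlpha, Matrix.fromBlocks_mulVec, Sum.elim_comp_inl, Sum.elim_comp_inr]
    simp

theorem mem_colSpan_iff_transpose_mulVec_eq_zero {α : Matrix (Fin p) (Fin r) ℝ}
    (hα : α.rank = r) {αperp : Matrix (Fin p) (Fin (p - r)) ℝ} (hrank : αperp.rank = p - r)
    (horth : αperp.transpose * α = 0) {u : Fin p → ℝ} :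
    u ∈ colSpan α ↔ αperp.transpose.mulVec u = 0 := by
  have hr : r ≤ p := hα ▸ α.rank_le_height
  have hle : LinearMap.range α.mulVecLin ≤ LinearMap.ker αperp.transpose.mulVecLin := by
    rintro _ ⟨v, rfl⟩
    rw [LinearMap.mem_ker, Matrix.mulVecLin_apply, Matrix.mulVecLin_apply, Matrix.mulVec_mulVec,
      horth, Matrix.zero_mulVec]
  have heq := Submodule.eq_of_le_of_finrank_eq hle (by
    have h1 := αperp.transpose.mulVecLin.finrank_range_add_finrank_ker
    have h2 : Module.finrank ℝ (LinearMap.range αperp.transpose.mulVecLin) = p - r :=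
      (Matrix.rank_transpose αperp).trans hrank
    have h3 : Module.finrank ℝ (LinearMap.range α.mulVecLin) = r := hα
    rw [h2, Module.finrank_fin_fun] at h1
    omega)
  rw [colSpan, ← Matrix.range_mulVecLin, heq]
  rfl

theorem col_mem_colSpan_iff {m : ℕ} {α : Matrix (Fin p) (Fin r) ℝ}
    (N : Matrix (Fin p) (Fin m) ℝ) :
    (∀ ε : Fin m → ℝ, N.mulVec ε ∈ colSpan α) ↔ ∀ j, N.col j ∈ colSpan α := by
  constructor
  · intro h j
    have := h (Pi.single j 1)
    rwa [Matrix.mulVec_single_one] at this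
  · intro h ε
    have h1 : N.mulVec ε ∈ colSpan N := mem_colSpan_iff.2 ⟨ε, rfl⟩
    refine (Submodule.span_le.2 ?_ : colSpan N ≤ colSpan α) h1
    rintro _ ⟨j, rfl⟩
    exact h j

end BlockMatrices

/-! ### Companion form of the model and its limits. -/

namespace NonlinearVAR

variable {p k r : ℕ}

/-- The lag terms `ζ_{j+1}` along the path, at time index `n`. -/
def lagState (M : NonlinearVAR p k) (u : Fin p → ℝ) (ς : Fin k → Fin p → ℝ) (j n : ℕ) :
    Fin p → ℝ :=
  ∑ l ∈ Finset.range (k - 1 - j), M.g (j + 1 + l) (M.path u ς (n - 1 - l))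

/-- The companion state `(f 0 (z t), ζ t)` at time index `n`. -/
def companionState (M : NonlinearVAR p k) (u : Fin p → ℝ) (ς : Fin k → Fin p → ℝ) (n : ℕ) :
    StateIndex p k → ℝ :=
  Sum.elim (M.f 0 (M.path u ς n)) fun q => M.lagState u ς q.1 n q.2

/-- The equilibrium error as a function of the companion state. -/
def errorMap (M : NonlinearVAR p k) (θ : (Fin p → ℝ) → Fin r → ℝ) (μ : Fin r → ℝ)
    (x : StateIndex p k → ℝ) : ErrorIndex p k r → ℝ :=
  M.boldTheta θ (M.f0inv (x ∘ Sum.inl)) + (boldD0 p k r).mulVec x + Sum.elim μ 0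

theorem f0inv_apply (M : NonlinearVAR p k) (hf : IsHomeomorph (M.f 0)) (z : Fin p → ℝ) :
    M.f0inv (M.f 0 z) = z := Function.leftInverse_invFun hf.injective z

theorem continuous_f0inv (M : NonlinearVAR p k) (hf : IsHomeomorph (M.f 0)) :
    Continuous M.f0inv := by
  have h : M.f0inv = (hf.homeomorph (M.f 0)).symm := by
    funext y
    obtain ⟨z, rfl⟩ := hf.surjective y
    rw [M.f0inv_apply hf]
    exact ((hf.homeomorph (M.f 0)).symm_apply_apply z).symm
  rw [h]
  exact (hf.homeomorph (M.f 0)).symm.continuous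

theorem g_eq_neg_add (M : NonlinearVAR p k) {j : ℕ} (hj : j < k) (z : Fin p → ℝ) :
    M.g j z = -M.f (j + 1) z + M.g (j + 1) z := by
  rw [g, g, ← Finset.add_sum_Ioc_eq_sum_Icc (by omega : j + 1 ≤ k), neg_add, Finset.Icc_add_one_left_eq_Ioc]

theorem g_self (M : NonlinearVAR p k) (z : Fin p → ℝ) : M.g k z = 0 := by
  simp [g]

theorem lagState_of_le (M : NonlinearVAR p k) (u : Fin p → ℝ) (ς : Fin k → Fin p → ℝ) {j : ℕ}
    (hj : k - 1 ≤ j) (n : ℕ) : M.lagState u ς j n = 0 := by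
  rw [lagState, Nat.sub_eq_zero_of_le hj, Finset.sum_range_zero]

theorem lagState_succ (M : NonlinearVAR p k) (u : Fin p → ℝ) (ς : Fin k → Fin p → ℝ) {j : ℕ}
    (hj : j < k - 1) (n : ℕ) :
    M.lagState u ς j (n + 1) = M.g (j + 1) (M.path u ς n) + M.lagState u ς (j + 1) n := by
  rw [lagState, lagState, show k - 1 - j = k - 1 - (j + 1) + 1 by omega, Finset.sum_range_succ',
    add_comm]
  congr 1
  refine Finset.sum_congr rfl fun l _ => ?_
  rw [show j + 1 + (l + 1) = j + 1 + 1 + l by omega,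
    show n + 1 - 1 - (l + 1) = n - 1 - l by omega]

/-- Consecutive `g` differ by a single `f`, so the difference recovers the lagged terms; the
vanishing term `g k` equalizes the lengths of the two sums. -/
theorem lagState_one_sub_zero (M : NonlinearVAR p k) (u : Fin p → ℝ) (ς : Fin k → Fin p → ℝ)
    (n : ℕ) : M.lagState u ς 1 n - M.lagState u ς 0 n =
      ∑ l ∈ Finset.range (k - 1), M.f (l + 2) (M.path u ς (n - (l + 1))) := by
  have h1 : M.lagState u ς 1 n =
      ∑ l ∈ Finset.range (k - 1), M.g (l + 2) (M.path u ς (n - 1 - l)) := by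
    rw [lagState]
    rcases Nat.lt_or_ge 1 k with h | h
    · rw [show k - 1 = k - 1 - 1 + 1 by omega, Finset.sum_range_succ,
        show k - 1 - 1 + 2 = k by omega, g_self, add_zero]
      exact Finset.sum_congr (by congr 1) fun l _ => by congr 1; omega
    · rw [show k - 1 = 0 by omega]; rfl
  rw [h1, lagState, Nat.sub_zero, ← Finset.sum_sub_distrib]
  refine Finset.sum_congr rfl fun l hl => ?_
  rw [Finset.mem_range] at hl
  rw [M.g_eq_neg_add (show 0 + 1 + l < k by omega), show 0 + 1 + l + 1 = l + 2 by omega,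
    show n - 1 - l = n - (l + 1) by omega]
  abel

/-- Error-correction form of the model. The shock enters only at index `k`, so it is absent from
every step `n → n + 1` with `k ≤ n`. -/
theorem f_zero_path_succ (M : NonlinearVAR p k) (hk : 1 ≤ k) (hf : IsHomeomorph (M.f 0))
    (u : Fin p → ℝ) (ς : Fin k → Fin p → ℝ) {n : ℕ} (hn : k ≤ n) :
    M.f 0 (M.path u ς (n + 1)) = M.f 0 (M.path u ς n) + (M.π (M.path u ς n) + M.c) +
      (M.g 1 (M.path u ς n) + (M.lagState u ς 1 n - M.lagState u ς 0 n)) := by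
  have hπ : M.π (M.path u ς n) = -M.f 0 (M.path u ς n) - M.g 0 (M.path u ς n) := by
    rw [π, g, sub_neg_eq_add]
  have hsum : ∀ φ : ℕ → Fin p → ℝ, ∑ i ∈ Finset.range k, φ i =
      ∑ i ∈ Finset.range (k - 1), φ (i + 1) + φ 0 := fun φ => by
    rw [← Finset.sum_range_succ', Nat.sub_add_cancel hk]
  rw [M.path_spec hf u ς (n + 1) (by omega), if_neg (by omega), add_zero, hπ,
    M.g_eq_neg_add (show 0 < k by omega), lagState_one_sub_zero,
    Fin.sum_univ_eq_sum_range (fun i => M.f (i + 1) (M.path u ς (n + 1 - (i + 1)))) k, hsum]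
  simp only [Nat.add_sub_add_right, zero_add, Nat.add_sub_cancel]
  abel

theorem errorMap_inl (M : NonlinearVAR p k) (θ : (Fin p → ℝ) → Fin r → ℝ) (μ : Fin r → ℝ)
    (x : StateIndex p k → ℝ) :
    M.errorMap θ μ x ∘ Sum.inl = θ (M.f0inv (x ∘ Sum.inl)) + μ := by
  rw [errorMap, boldD0, Matrix.fromBlocks_mulVec]
  ext i
  simp [boldTheta]

theorem errorMap_inr (M : NonlinearVAR p k) (θ : (Fin p → ℝ) → Fin r → ℝ) (μ : Fin r → ℝ)
    (x : StateIndex p k → ℝ) : M.errorMap θ μ x ∘ Sum.inr =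
      (fun q => M.g ((q.1 : ℕ) + 1) (M.f0inv (x ∘ Sum.inl)) q.2) +
        (blockD p k).mulVec (x ∘ Sum.inr) := by
  rw [errorMap, boldD0, Matrix.fromBlocks_mulVec]
  ext i
  simp [boldTheta]

theorem errorMap_companionState_inr (M : NonlinearVAR p k) (hf : IsHomeomorph (M.f 0))
    (θ : (Fin p → ℝ) → Fin r → ℝ) (μ : Fin r → ℝ) (u : Fin p → ℝ) (ς : Fin k → Fin p → ℝ) (n : ℕ)
    (j : Fin (k - 1)) (a : Fin p) :
    M.errorMap θ μ (M.companionState u ς n) (Sum.inr (j, a)) =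
      M.g (j + 1) (M.path u ς n) a +
        (M.lagState u ς (j + 1) n a - M.lagState u ς j n a) := by
  have h := congrFun (M.errorMap_inr θ μ (M.companionState u ς n)) (j, a)
  rw [Function.comp_apply] at h
  rw [h, Pi.add_apply, companionState, Sum.elim_comp_inl, Sum.elim_comp_inr, M.f0inv_apply hf,
    blockD_mulVec]
  congr 1
  split_ifs with hj
  · simp only; ring
  · rw [M.lagState_of_le u ς (j := j + 1) (by omega)]
    simp

theorem companionState_succ (M : NonlinearVAR p k) (hk : 1 ≤ k) (hf : IsHomeomorph (M.f 0))
    {α : Matrix (Fin p) (Fin r) ℝ} {θ : (Fin p → ℝ) → Fin r → ℝ} {μ : Fin r → ℝ}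
    (hc : M.c = α.mulVec μ) (hπ : ∀ z, M.π z = α.mulVec (θ z))
    (u : Fin p → ℝ) (ς : Fin k → Fin p → ℝ) {n : ℕ} (hn : k ≤ n) :
    M.companionState u ς (n + 1) = M.companionState u ς n +
      (boldAlpha k α).mulVec (M.errorMap θ μ (M.companionState u ς n)) := by
  have hE := M.errorMap_companionState_inr hf θ μ u ς n
  rw [boldAlpha, Matrix.fromBlocks_mulVec, errorMap_inl]
  ext (a | ⟨j, a⟩)
  · have h1 : (blockE p k).transpose.mulVec
        (M.errorMap θ μ (M.companionState u ς n) ∘ Sum.inr) a =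
        M.g 1 (M.path u ς n) a + (M.lagState u ς 1 n a - M.lagState u ς 0 n a) := by
      rw [blockE_transpose_mulVec]
      split_ifs with h
      · rw [Function.comp_apply, hE]
      -- For `k = 1` there are no lag blocks, and `g 1` is an empty sum.
      · rw [M.lagState_of_le u ς (j := 1) (by omega), M.lagState_of_le u ς (j := 0) (by omega)]
        have : k = 1 := by omega
        subst this
        simp [g_self]
    have h2 := congrFun (M.f_zero_path_succ hk hf u ς hn) a
    simp only [Pi.add_apply, Sum.elim_inl, h1]
    simp only [companionState, Sum.elim_inl, Sum.elim_comp_inl, M.f0inv_apply hf,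
      Matrix.mulVec_add, ← hπ, ← hc, h2, Pi.add_apply, Pi.sub_apply]
    ring
  · simp only [Pi.add_apply, Sum.elim_inr, Matrix.zero_mulVec, Matrix.one_mulVec, zero_add,
      Function.comp_apply, hE]
    simp only [companionState, Sum.elim_inr, M.lagState_succ u ς j.2, Pi.add_apply]
    ring

theorem path_of_lt (M : NonlinearVAR p k) (u v : Fin p → ℝ) (ς : Fin k → Fin p → ℝ) {n : ℕ}
    (hn : n < k) : M.path u ς n = M.path v ς n := by
  rw [path, path, dif_pos hn, dif_pos hn]

/-- On impact the shock shifts only f_0(z_τ): the lag part depends solely on values before τ. -/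
theorem companionState_sub (M : NonlinearVAR p k) (hk : 1 ≤ k) (hf : IsHomeomorph (M.f 0))
    (u : Fin p → ℝ) (ς : Fin k → Fin p → ℝ) :
    M.companionState u ς k - M.companionState 0 ς k = Sum.elim u 0 := by
  have h1 : M.f 0 (M.path u ς k) = M.f 0 (M.path 0 ς k) + u := by
    rw [M.path_spec hf u ς k le_rfl, M.path_spec hf 0 ς k le_rfl, if_pos rfl, if_pos rfl, add_zero]
    congr 2
    exact Finset.sum_congr rfl fun i _ => by rw [M.path_of_lt u 0 ς (by omega)]
  have h2 : ∀ j, M.lagState u ς j k = M.lagState 0 ς j k := fun j =>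
    Finset.sum_congr rfl fun l _ => by rw [M.path_of_lt u 0 ς (by omega)]
  ext (a | q)
  · simp [companionState, h1]
  · simp [companionState, h2]

/-- Orbits of the companion states converge, and their limits and differences are governed by the
span of `α`. -/
theorem InCVAR.companionState_limits (hk : 1 ≤ k) {M : NonlinearVAR p k}
    {α : Matrix (Fin p) (Fin r) ℝ} {b ρ : ℝ} (hM : M.InCVAR α b ρ) (ς : Fin k → Fin p → ℝ) :
    ∃ X : (Fin p → ℝ) → StateIndex p k → ℝ,
      (∀ u, Tendsto (fun h => M.companionState u ς (k + h)) atTop (𝓝 (X u))) ∧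
      ∀ u, X u ∘ Sum.inl = X 0 ∘ Sum.inl ↔ u ∈ colSpan α := by
  obtain ⟨-, -, hρ1, hf, μ, θ, hc, hπ, B, -, hBb, hBsub, hjsr⟩ := hM
  have hF : IsErrorCorrecting (M.errorMap θ μ) (boldAlpha k α) B b := by
    refine ⟨fun β hβ i j => (abs_apply_le_inducedNorm β i j).trans (hBb β hβ), fun x y => ?_,
      hjsr.trans_lt (ENNReal.ofReal_lt_one.2 hρ1)⟩
    obtain ⟨β, hβ, he⟩ :=
      hBsub (x ∘ Sum.inl) (y ∘ Sum.inl) (x ∘ Sum.inr) (y ∘ Sum.inr)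
    refine ⟨β, hβ, ?_⟩
    simp only [Sum.elim_comp_inl_inr] at he
    rw [← he, errorMap, errorMap, add_sub_add_right_eq_sub]
  have hstep : ∀ u t, M.companionState u ς (k + (t + 1)) = M.companionState u ς (k + t) +
      (boldAlpha k α).mulVec (M.errorMap θ μ (M.companionState u ς (k + t))) := fun u t =>
    M.companionState_succ hk hf hc hπ u ς (Nat.le_add_right k t)
  choose X hX hFX v hv using fun u =>
    hF.exists_tendsto (fun h => M.companionState u ς (k + h)) (hstep u)
  refine ⟨X, hX, fun u => ?_⟩
  rw [← boldAlpha_mulVec_eq_elim_zero_iff (k := k), ← M.companionState_sub hk hf u ς]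
  constructor
  · intro hinl
    -- At a zero of the error map, D ζ is determined by the first block, hence so is ζ.
    have hinr : X u ∘ Sum.inr = X 0 ∘ Sum.inr := by
      have h1 := M.errorMap_inr θ μ (X u)
      have h2 := M.errorMap_inr θ μ (X 0)
      rw [hFX, hinl] at h1
      rw [hFX] at h2
      exact blockD_mulVec_injective (add_left_cancel (h1.symm.trans h2))
    have hXX : X u = X 0 := by
      rw [← Sum.elim_comp_inl_inr (X u), ← Sum.elim_comp_inl_inr (X 0), hinl, hinr]
    -- With a common limit, the initial states differ by the difference of their displacements.
    refine ⟨v 0 - v u, ?_⟩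
    rw [Matrix.mulVec_sub, ← hv, ← hv, hXX, add_zero]
    abel
  · rintro ⟨w, hw⟩
    have h1 := hF.tendsto_sub_zero (fun h => M.companionState u ς (k + h))
      (fun h => M.companionState 0 ς (k + h)) (hstep u) (hstep 0) w (by simpa using hw)
    rw [sub_eq_zero.1 (tendsto_nhds_unique ((hX u).sub (hX 0)) h1)]

theorem InCVAR.exists_limit (hk : 1 ≤ k) {M : NonlinearVAR p k}
    {α : Matrix (Fin p) (Fin r) ℝ} {b ρ : ℝ} (hM : M.InCVAR α b ρ) (ς : Fin k → Fin p → ℝ) :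
    ∃ Z : (Fin p → ℝ) → Fin p → ℝ, (∀ u, Tendsto (M.response u ς) atTop (𝓝 (Z u))) ∧
      ∀ u, Z u = Z 0 ↔ u ∈ colSpan α := by
  obtain ⟨X, hX, hiff⟩ := hM.companionState_limits hk ς
  have hcont := M.continuous_f0inv hM.homeo
  refine ⟨fun u => M.f0inv (X u ∘ Sum.inl), fun u => ?_, fun u => ?_⟩
  · have hproj : Continuous fun x : StateIndex p k → ℝ => M.f0inv (x ∘ Sum.inl) :=
      hcont.comp (continuous_pi fun i => continuous_apply (Sum.inl i))
    refine ((hproj.tendsto (X u)).comp (hX u)).congr fun h => ?_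
    rw [Function.comp_apply, companionState, Sum.elim_comp_inl, M.f0inv_apply hM.homeo]
    rfl
  · rw [← hiff]
    refine ⟨fun h => ?_, fun h => congrArg M.f0inv h⟩
    have h1 := congrArg (M.f 0) h
    have hinv : ∀ y, M.f 0 (M.f0inv y) = y := Function.rightInverse_invFun hM.homeo.surjective
    rwa [hinv, hinv] at h1

end NonlinearVAR

end

theorem mainTheorem3 {p k r : ℕ} (hk : 1 ≤ k) (M : NonlinearVAR p k)
    (α : Matrix (Fin p) (Fin r) ℝ) (b ρ : ℝ) (hM : M.InCVAR α b ρ) :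
    (∀ (u : Fin p → ℝ) (ς : Fin k → Fin p → ℝ),
      Tendsto (M.response u ς) atTop (𝓝 (M.zInfty u ς))) ∧
    (∀ ς : Fin k → Fin p → ℝ,
      {u : Fin p → ℝ | M.zInfty u ς = M.zInfty 0 ς} = (colSpan α : Set (Fin p → ℝ))) ∧
    (∀ (ς : Fin k → Fin p → ℝ) (u : Fin p → ℝ),
      M.NoPermanentEffect ς u ↔ u ∈ colSpan α) ∧
    (∀ (αperp : Matrix (Fin p) (Fin (p - r)) ℝ), αperp.rank = p - r →
      αperp.transpose * α = 0 →
      ∀ m : ℕ, 1 ≤ m → m ≤ r → ∀ Υ ∈ Matrix.orthogonalGroup (Fin p) ℝ,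
        (∀ ς : Fin k → Fin p → ℝ,
          (∀ ε₁ : Fin m → ℝ, M.NoPermanentEffect ς ((Υ * firstColumns p m).mulVec ε₁)) ↔
            ∀ j, (Υ * firstColumns p m).col j ∈ colSpan α) ∧
        ((∀ j, (Υ * firstColumns p m).col j ∈ colSpan α) ↔
          αperp.transpose * Υ * firstColumns p m = 0)) := by
  have hlim : ∀ u ς, Tendsto (M.response u ς) atTop (𝓝 (M.zInfty u ς)) := fun u ς => by
    obtain ⟨Z, hZ, -⟩ := hM.exists_limit hk ς
    exact tendsto_nhds_limUnder ⟨_, hZ u⟩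
  have hspan : ∀ ς u, M.zInfty u ς = M.zInfty 0 ς ↔ u ∈ colSpan α := fun ς u => by
    obtain ⟨Z, hZ, hiff⟩ := hM.exists_limit hk ς
    rw [tendsto_nhds_unique (hlim u ς) (hZ u), tendsto_nhds_unique (hlim 0 ς) (hZ 0), hiff]
  have hperm : ∀ ς u, M.NoPermanentEffect ς u ↔ u ∈ colSpan α := fun ς u => by
    have hsub := (hlim u ς).sub (hlim 0 ς)
    rw [← hspan ς u, ← sub_eq_zero]
    -- Both paths converge, so their difference tends to zero exactly when the limits agree.
    refine ⟨fun h => tendsto_nhds_unique hsub h, fun h => ?_⟩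
    rw [h] at hsub
    exact hsub
  refine ⟨hlim, fun ς => Set.ext fun u => hspan ς u, hperm, ?_⟩
  intro αperp hrank horth m _ _ Υ _
  refine ⟨fun ς => ?_, ?_⟩
  · simp only [hperm]
    exact col_mem_colSpan_iff _
  · simp only [mem_colSpan_iff_transpose_mulVec_eq_zero hM.rank_eq hrank horth]
    rw [Matrix.mul_assoc, ← Matrix.ext_iff, forall_comm]
    exact forall_congr' fun j => funext_iff
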